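/- Let $n\ge 1$, let $a=(a_1,\dots,a_n)\in\mathbb R^n$ with $\sum_j a_j^2=1$, and let $k\in\{1,\dots,n\}$. Put $$D_k^{\mathbb R}(a)=\frac2\pi\int_0^\infty\prod_{j\ne k}\frac{\sin(a_js)}{a_js}\,\cos(a_ks)\,ds,\qquad D_k^{\mathbb C}(a)=\frac12\int_0^\infty\prod_{j\ne k}j_1(a_js)\,J_0(a_ks)\,s\,ds,$$ where $J_\nu$ is the Bessel function of the first kind of order $\nu$, $j_1(t)=2J_1(t)/t$, the quotients $\frac{\sin(a_js)}{a_js}$ and $j_1(a_js)$ are read as $1$ where $a_js=0$, and $\int_0^\infty=\lim_{T\to\infty}\int_0^T$. Let $$A_{n-1}(a)=\mathrm{vol}_{n-1}\Big\{x\in\mathbb R^n:\ \max_i|x_i|\le\tfrac12,\ \langle x,a\rangle=0\Big\},\qquad A_{2(n-1)}(a)=\mathrm{vol}_{2(n-1)}\Big\{z\in\mathbb C^n:\ \max_i|z_i|\le\tfrac1{\sqrt\pi},\ \langle z,a\rangle=0\Big\}$$ be the volumes of the central hyperplane sections orthogonal to $a$ of the cube in $\mathbb R^n$ and of the polydisc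 in $\mathbb C^n=\mathbb R^{2n}$ of volume $1$. If $a_j\neq0$ for some $j\ne k$, then both improper integrals converge. In all cases $$D_k^{\mathbb R}(a)\le A_{n-1}(a)\qquad\text{and}\qquad D_k^{\mathbb C}(a)\le A_{2(n-1)}(a),$$ where in the remaining case $a=\pm e_k$ (with $e_k$ the $k$-th standard unit vector), in which the integrals $\int_0^\infty\cos s\,ds$ and $\int_0^\infty J_0(s)\,s\,ds$ diverge, one sets $D_k^{\mathbb R}(a)=D_k^{\mathbb C}(a)=0$. -/

import Mathlib

open MeasureTheory Filter Topology

noncomputable section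

namespace CubeSection

/-- `L` is the value of the improper Riemann integral `∫_0^∞ f(s) ds = lim_{T → ∞} ∫_0^T f(s) ds`
(possibly only conditionally convergent; used for continuous `f`). -/
def HasImproperIntegral (f : ℝ → ℝ) (L : ℝ) : Prop :=
  Tendsto (fun T : ℝ => ∫ s in (0 : ℝ)..T, f s) atTop (𝓝 L)

/-- The improper integral `∫_0^∞ f(s) ds` converges. -/
def ImproperConvergent (f : ℝ → ℝ) : Prop := ∃ L, HasImproperIntegral f L

open Classical in
/-- The value of `∫_0^∞ f(s) ds`, with the convention that it is `0` if the integral diverges. -/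
def improperIntegral (f : ℝ → ℝ) : ℝ :=
  if h : ImproperConvergent f then h.choose else 0

/-- The Bessel function `J_ν` of the first kind of integer order `ν ≥ 0`, on the real line, by
Bessel's integral `J_ν(x) = (1/π) ∫_0^π cos(ν τ - x sin τ) dτ`. -/
def besselJ (ν : ℕ) (x : ℝ) : ℝ :=
  (1 / Real.pi) * ∫ τ in (0 : ℝ)..Real.pi, Real.cos (ν * τ - x * Real.sin τ)

/-- `j_1(t) = 2 J_1(t) / t`, with `j_1(0) = 1`. -/
def jOne (t : ℝ) : ℝ := if t = 0 then 1 else 2 * besselJ 1 t / t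

/-- The integrand `∏_{j ≠ k} (sin(a_j s) / (a_j s)) · cos(a_k s)`. -/
def integrandReal {n : ℕ} (a : EuclideanSpace ℝ (Fin n)) (k : Fin n) (s : ℝ) : ℝ :=
  (∏ j ∈ Finset.univ.erase k, Real.sinc (a j * s)) * Real.cos (a k * s)

/-- The integrand `∏_{j ≠ k} j_1(a_j s) · J_0(a_k s) · s`. -/
def integrandComplex {n : ℕ} (a : EuclideanSpace ℝ (Fin n)) (k : Fin n) (s : ℝ) : ℝ :=
  (∏ j ∈ Finset.univ.erase k, jOne (a j * s)) * besselJ 0 (a k * s) * s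

/-- `D_k(a)` in the real case. -/
def dReal {n : ℕ} (a : EuclideanSpace ℝ (Fin n)) (k : Fin n) : ℝ :=
  (2 / Real.pi) * improperIntegral (integrandReal a k)

/-- `D_k(a)` in the complex case. -/
def dComplex {n : ℕ} (a : EuclideanSpace ℝ (Fin n)) (k : Fin n) : ℝ :=
  (1 / 2) * improperIntegral (integrandComplex a k)

/-- The cube of volume one in `ℝⁿ`. -/
def cubeReal (n : ℕ) : Set (EuclideanSpace ℝ (Fin n)) :=
  {x | ∀ i, ‖x i‖ ≤ 1 / 2}

/-- The polydisc of volume one in `ℂⁿ`. -/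
def cubeComplex (n : ℕ) : Set (EuclideanSpace ℂ (Fin n)) :=
  {x | ∀ i, ‖x i‖ ≤ 1 / Real.sqrt Real.pi}

/-- `A_{n-1}(a)`: the `(n-1)`-dimensional volume of the section of the cube in `ℝⁿ` by `a^⊥`. -/
def sectionVolumeReal {n : ℕ} (a : EuclideanSpace ℝ (Fin n)) : ℝ :=
  (μHE[n - 1] (cubeReal n ∩ {x | inner ℝ a x = 0})).toReal

/-- `A_{2(n-1)}(a)`: the real `2(n-1)`-dimensional volume of the section of the polydisc in `ℂⁿ`
by the complex hyperplane `a^⊥`. -/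
def sectionVolumeComplex {n : ℕ} (a : EuclideanSpace ℂ (Fin n)) : ℝ :=
  (μHE[2 * (n - 1)] (cubeComplex n ∩ {x | inner ℂ a x = 0})).toReal

/-- A vector of `ℝⁿ` regarded as a vector of `ℂⁿ`. -/
def complexify {n : ℕ} (a : EuclideanSpace ℝ (Fin n)) : EuclideanSpace ℂ (Fin n) :=
  WithLp.toLp 2 (fun i => (a i : ℂ))

end CubeSection

end

namespace CubeSection

/-! Let `F` be `ℝ` or `ℂ`, let `r` be the radius of the ball of volume one in `F`, and let the `Z_j`
be independent and uniform on that ball. Since `a` is a unit vector, the section volume is the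
density of `∑ a_j Z_j` at `0`. Fourier inversion identifies `D_k(a)` with the density of the partial
sum `∑_{j ≠ k} a_j Z_j` at `a_k e`, where `‖e‖ = r`: the characteristic function of `Z_j` is a
`sinc` or a `jOne`, and the cosine or `J₀` comes from the shift by `a_k e`.

The density of the full sum at `0` is the average of the density of the partial sum over the points
`a_k z` with `‖z‖ ≤ r`. None of these points is farther from `0` than `a_k e`, so the inequality
follows once the density of the partial sum is known to decrease with the norm
(`ballSmoothing_succAbove_smul_le`). This monotonicity survives averaging over a centred ball, by a
reflection argument (`RadiallyDecreasing.setLIntegral_closedBall`), hence any number of such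
averagings.

Densities need not exist pointwise and the integrals converge only conditionally, so everything is
done with a Gaussian of width `c` added to the sum, and `c → 0` at the end. The Fourier side is then
absolutely convergent (`integral_pi_gaussKernel`) and tends to the improper integral
(`HasImproperIntegral.tendsto_integral_mul_gaussian`). On the geometric side an upper bound for the
limit suffices, and it follows from closedness of the cube or polydisc
(`limsup_ballSmoothing_gaussKernel_le`).

Convergence of the integrals is separate. Two nonzero coefficients besides `a_k` give a decay of
order `s⁻²`; with only one, an explicit approximate primitive is used. -/

/-! ### The Bessel functions `J₀` and `J₁`: derivatives and decay. -/

theorem besselJ_zero_eq (x : ℝ) :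
    besselJ 0 x = (1 / Real.pi) * ∫ τ in (0 : ℝ)..Real.pi, Real.cos (x * Real.sin τ) := by
  simp [besselJ]

theorem besselJ_one_eq (x : ℝ) :
    besselJ 1 x =
      (1 / Real.pi) * ∫ τ in (0 : ℝ)..Real.pi, Real.sin τ * Real.sin (x * Real.sin τ) := by
  -- The substitution `τ ↦ π - τ` changes the sign of the integrand.
  have hodd : ∫ τ in (0 : ℝ)..Real.pi, Real.cos τ * Real.cos (x * Real.sin τ) = 0 := by
    have h := intervalIntegral.integral_comp_sub_left (a := 0) (b := Real.pi)
      (fun τ => Real.cos τ * Real.cos (x * Real.sin τ)) Real.pi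
    simp only [Real.cos_pi_sub, Real.sin_pi_sub, sub_self, sub_zero, neg_mul,
      intervalIntegral.integral_neg] at h
    linarith
  have hadd := intervalIntegral.integral_add (μ := volume) (a := 0) (b := Real.pi)
    (f := fun τ => Real.cos τ * Real.cos (x * Real.sin τ))
    (g := fun τ => Real.sin τ * Real.sin (x * Real.sin τ))
    (by apply Continuous.intervalIntegrable; fun_prop)
    (by apply Continuous.intervalIntegrable; fun_prop)
  rw [hodd, zero_add] at hadd
  rw [besselJ, ← hadd]
  simp only [Nat.cast_one, one_mul, Real.cos_sub]

theorem besselJ_zero_neg (x : ℝ) : besselJ 0 (-x) = besselJ 0 x := by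
  simp [besselJ_zero_eq]

theorem besselJ_one_neg (x : ℝ) : besselJ 1 (-x) = -besselJ 1 x := by
  simp [besselJ_one_eq]

theorem besselJ_zero_zero : besselJ 0 0 = 1 := by
  simp [besselJ_zero_eq, Real.pi_ne_zero]

theorem besselJ_one_zero : besselJ 1 0 = 0 := by
  simp [besselJ_one_eq]

theorem abs_besselJ_le_one (ν : ℕ) (x : ℝ) : |besselJ ν x| ≤ 1 := by
  have h := intervalIntegral.norm_integral_le_of_norm_le_const (a := 0) (b := Real.pi) (C := 1)
    (f := fun τ => Real.cos (ν * τ - x * Real.sin τ))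
    (fun τ _ => by simpa using Real.abs_cos_le_one _)
  have hpi := Real.pi_pos
  rw [besselJ, abs_mul, abs_of_pos (by positivity), one_div, inv_mul_le_iff₀ hpi]
  simpa [abs_of_pos hpi] using h

theorem abs_besselJ_one_le (x : ℝ) : |besselJ 1 x| ≤ |x| / 2 := by
  have hpi := Real.pi_pos
  have h : ‖∫ τ in (0 : ℝ)..Real.pi, Real.sin τ * Real.sin (x * Real.sin τ)‖
      ≤ ∫ τ in (0 : ℝ)..Real.pi, |x| * Real.sin τ ^ 2 := by
    refine intervalIntegral.norm_integral_le_of_norm_le hpi.le (ae_of_all _ fun τ _ => ?_)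
      (by apply Continuous.intervalIntegrable; fun_prop)
    have h1 : |Real.sin (x * Real.sin τ)| ≤ |x * Real.sin τ| := Real.abs_sin_le_abs
    rw [abs_mul] at h1
    rw [Real.norm_eq_abs, abs_mul, ← sq_abs (Real.sin τ)]
    nlinarith [abs_nonneg (Real.sin τ)]
  rw [intervalIntegral.integral_const_mul, integral_sin_sq] at h
  simp only [Real.sin_zero, Real.sin_pi, zero_mul, sub_zero, zero_add, Real.norm_eq_abs] at h
  rw [besselJ_one_eq, abs_mul, abs_of_pos (by positivity), one_div, inv_mul_le_iff₀ hpi]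
  linarith

theorem hasDerivAt_besselJ_zero (x : ℝ) : HasDerivAt (besselJ 0) (-besselJ 1 x) x := by
  have h := intervalIntegral.hasDerivAt_integral_of_dominated_loc_of_deriv_le (μ := volume)
    (a := 0) (b := Real.pi) (F := fun x τ => Real.cos (x * Real.sin τ))
    (F' := fun x τ => -Real.sin (x * Real.sin τ) * Real.sin τ) (x₀ := x) (s := Set.univ)
    (bound := fun _ => 1) univ_mem
    (Eventually.of_forall fun y => by apply Continuous.aestronglyMeasurable; fun_prop)
    (by apply Continuous.intervalIntegrable; fun_prop)
    (by apply Continuous.aestronglyMeasurable; fun_prop)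
    (ae_of_all _ fun τ _ y _ => by
      rw [Real.norm_eq_abs, abs_mul, abs_neg]
      exact mul_le_one₀ (Real.abs_sin_le_one _) (abs_nonneg _) (Real.abs_sin_le_one _))
    (by simp)
    (ae_of_all _ fun τ _ y _ => by
      simpa using ((hasDerivAt_id y).mul_const (Real.sin τ)).cos)
  have h2 := h.2.const_mul (1 / Real.pi)
  rw [show besselJ 0 = fun x => (1 / Real.pi) * ∫ τ in (0 : ℝ)..Real.pi, Real.cos (x * Real.sin τ)
    from funext besselJ_zero_eq]
  convert! h2 using 1
  rw [besselJ_one_eq, ← mul_neg, ← intervalIntegral.integral_neg]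
  congr 2
  funext τ
  ring

theorem hasDerivAt_besselJ_one_aux (x : ℝ) : HasDerivAt (besselJ 1)
    ((1 / Real.pi) * ∫ τ in (0 : ℝ)..Real.pi, Real.sin τ ^ 2 * Real.cos (x * Real.sin τ)) x := by
  have h := intervalIntegral.hasDerivAt_integral_of_dominated_loc_of_deriv_le (μ := volume)
    (a := 0) (b := Real.pi) (F := fun x τ => Real.sin τ * Real.sin (x * Real.sin τ))
    (F' := fun x τ => Real.sin τ ^ 2 * Real.cos (x * Real.sin τ)) (x₀ := x) (s := Set.univ)
    (bound := fun _ => 1) univ_mem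
    (Eventually.of_forall fun y => by apply Continuous.aestronglyMeasurable; fun_prop)
    (by apply Continuous.intervalIntegrable; fun_prop)
    (by apply Continuous.aestronglyMeasurable; fun_prop)
    (ae_of_all _ fun τ _ y _ => by
      rw [Real.norm_eq_abs, abs_mul, abs_pow]
      exact mul_le_one₀ (pow_le_one₀ (abs_nonneg _) (Real.abs_sin_le_one _)) (abs_nonneg _)
        (Real.abs_cos_le_one _))
    (by simp)
    (ae_of_all _ fun τ _ y _ => by
      have h1 := (((hasDerivAt_id y).mul_const (Real.sin τ)).sin).const_mul (Real.sin τ)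
      simp only [id, one_mul] at h1
      convert! h1 using 1
      ring)
  have h2 := h.2.const_mul (1 / Real.pi)
  rw [show besselJ 1 = fun x => (1 / Real.pi) *
    ∫ τ in (0 : ℝ)..Real.pi, Real.sin τ * Real.sin (x * Real.sin τ) from funext besselJ_one_eq]
  exact h2

theorem hasDerivAt_mul_besselJ_one (x : ℝ) :
    HasDerivAt (fun x => x * besselJ 1 x) (x * besselJ 0 x) x := by
  have h := (hasDerivAt_id x).mul (hasDerivAt_besselJ_one_aux x)
  convert! h using 1
  -- The integrand is the `τ`-derivative of `cos τ · sin (x sin τ)`, which vanishes at both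
  -- endpoints.
  have hparts : ∫ τ in (0 : ℝ)..Real.pi, (x * Real.cos τ ^ 2 * Real.cos (x * Real.sin τ)
      - Real.sin τ * Real.sin (x * Real.sin τ)) = 0 := by
    rw [intervalIntegral.integral_eq_sub_of_hasDerivAt
      (f := fun τ => Real.cos τ * Real.sin (x * Real.sin τ)) (fun τ _ => ?_)
      (by apply Continuous.intervalIntegrable; fun_prop)]
    · simp
    · have h1 := (Real.hasDerivAt_cos τ).mul ((Real.hasDerivAt_sin τ).const_mul x).sin
      convert! h1 using 1
      ring
  have hadd : ∫ τ in (0 : ℝ)..Real.pi, x * Real.cos (x * Real.sin τ) =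
      (∫ τ in (0 : ℝ)..Real.pi, (x * Real.cos τ ^ 2 * Real.cos (x * Real.sin τ)
        - Real.sin τ * Real.sin (x * Real.sin τ))) +
      ((∫ τ in (0 : ℝ)..Real.pi, Real.sin τ * Real.sin (x * Real.sin τ)) +
        ∫ τ in (0 : ℝ)..Real.pi, x * (Real.sin τ ^ 2 * Real.cos (x * Real.sin τ))) := by
    rw [← intervalIntegral.integral_add, ← intervalIntegral.integral_add]
    · congr 1
      funext τ
      linear_combination (-x * Real.cos (x * Real.sin τ)) * Real.sin_sq_add_cos_sq τ
    all_goals apply Continuous.intervalIntegrable; fun_prop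
  rw [hparts, intervalIntegral.integral_const_mul, intervalIntegral.integral_const_mul] at hadd
  rw [besselJ_zero_eq, besselJ_one_eq]
  simp only [id]
  linear_combination (1 / Real.pi) * hadd

theorem hasDerivAt_besselJ_one {x : ℝ} (hx : x ≠ 0) :
    HasDerivAt (besselJ 1) (besselJ 0 x - besselJ 1 x / x) x := by
  have h1 := hasDerivAt_besselJ_one_aux x
  have h2 := ((hasDerivAt_id x).mul h1).unique (hasDerivAt_mul_besselJ_one x)
  convert! h1 using 1
  simp only [id] at h2
  field_simp at h2 ⊢
  linarith

theorem continuous_besselJ_zero : Continuous (besselJ 0) :=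
  continuous_iff_continuousAt.2 fun x => (hasDerivAt_besselJ_zero x).continuousAt

theorem continuous_besselJ_one : Continuous (besselJ 1) :=
  continuous_iff_continuousAt.2 fun x => (hasDerivAt_besselJ_one_aux x).continuousAt

/-- Both `J₀` and `J₁` decay like `|t|^(-1/2)`. -/
theorem exists_abs_mul_besselJ_sq_add_sq_le :
    ∃ C, ∀ t : ℝ, |t| * (besselJ 0 t ^ 2 + besselJ 1 t ^ 2) ≤ C := by
  -- The correction `- J₀ J₁` cancels the non-decaying part `J₀² - J₁²` of the derivative of `t (J₀²
  -- + J₁²)`, leaving `J₀ J₁ / t`.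
  let E : ℝ → ℝ := fun t => t * (besselJ 0 t ^ 2 + besselJ 1 t ^ 2) - besselJ 0 t * besselJ 1 t
  have hE : ∀ t : ℝ, 0 < t → HasDerivAt E (besselJ 0 t * besselJ 1 t / t) t := by
    intro t ht
    have h0 := hasDerivAt_besselJ_zero t
    have h1 := hasDerivAt_besselJ_one ht.ne'
    have h := ((hasDerivAt_id t).mul ((h0.pow 2).add (h1.pow 2))).sub (h0.mul h1)
    convert! h using 1
    simp only [id, Pi.add_apply, Pi.pow_apply]
    field_simp
    ring
  have hlow : ∀ t : ℝ, (t - 1 / 2) * (besselJ 0 t ^ 2 + besselJ 1 t ^ 2) ≤ E t := by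
    intro t
    simp only [E]
    nlinarith [sq_nonneg (besselJ 0 t - besselJ 1 t)]
  -- A Grönwall integrating factor: for `t ≥ 1` one has `J₀ J₁ / t ≤ E / t²`, and `exp (1 / t)`
  -- absorbs exactly this growth.
  let V : ℝ → ℝ := fun t => E t * Real.exp (1 / t)
  have hV : ∀ t : ℝ, 0 < t → HasDerivAt V (besselJ 0 t * besselJ 1 t / t * Real.exp (1 / t) +
      E t * (Real.exp (1 / t) * (-(t ^ 2)⁻¹))) t := by
    intro t ht
    have := (hE t ht).mul (hasDerivAt_inv ht.ne').exp
    simpa [V, one_div] using! this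
  have hanti : AntitoneOn V (Set.Ici 1) := by
    apply antitoneOn_of_deriv_nonpos (convex_Ici 1)
    · exact fun t ht => (hV t (lt_of_lt_of_le one_pos ht)).continuousAt.continuousWithinAt
    · intro t ht
      rw [interior_Ici] at ht
      exact (hV t (one_pos.trans ht)).differentiableAt.differentiableWithinAt
    · intro t ht
      rw [interior_Ici] at ht
      have ht1 : (1 : ℝ) < t := ht
      have ht0 : 0 < t := one_pos.trans ht1
      rw [(hV t ht0).deriv]
      have hkey : besselJ 0 t * besselJ 1 t * t ≤ E t := by
        refine le_trans ?_ (hlow t)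
        nlinarith [sq_nonneg (besselJ 0 t - besselJ 1 t), sq_nonneg (besselJ 0 t),
          sq_nonneg (besselJ 1 t), mul_nonneg (sub_nonneg.2 ht1.le) (add_nonneg
          (sq_nonneg (besselJ 0 t)) (sq_nonneg (besselJ 1 t))),
          mul_nonneg ht0.le (sq_nonneg (besselJ 0 t - besselJ 1 t))]
      have hrw : besselJ 0 t * besselJ 1 t / t * Real.exp (1 / t) +
          E t * (Real.exp (1 / t) * (-(t ^ 2)⁻¹)) =
          -((E t - besselJ 0 t * besselJ 1 t * t) * (Real.exp (1 / t) * (t ^ 2)⁻¹)) := by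
        field_simp
        ring
      rw [hrw, neg_nonpos]
      exact mul_nonneg (sub_nonneg.2 hkey) (by positivity)
  have hpos : ∀ t : ℝ, 0 ≤ t → t * (besselJ 0 t ^ 2 + besselJ 1 t ^ 2) ≤ 2 * |V 1| + 2 := by
    intro t ht
    rcases le_total 1 t with h1 | h1
    · have hle : V t ≤ V 1 := hanti (Set.mem_Ici.2 le_rfl) (Set.mem_Ici.2 h1) h1
      have hEnn : 0 ≤ E t := le_trans (mul_nonneg (by linarith) (by positivity)) (hlow t)
      have hexp : 1 ≤ Real.exp (1 / t) := Real.one_le_exp (by positivity)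
      have h2 : E t ≤ V t := le_mul_of_one_le_right hEnn hexp
      have h3 := hlow t
      -- For `t ≥ 1`, `t ≤ 2 (t - 1/2)`; this is the factor `2` in the final constant.
      have h4 : t * (besselJ 0 t ^ 2 + besselJ 1 t ^ 2) ≤
          2 * ((t - 1 / 2) * (besselJ 0 t ^ 2 + besselJ 1 t ^ 2)) := by
        nlinarith [add_nonneg (sq_nonneg (besselJ 0 t)) (sq_nonneg (besselJ 1 t))]
      linarith [le_abs_self (V 1)]
    · have h2 : besselJ 0 t ^ 2 ≤ 1 := (sq_le_one_iff_abs_le_one _).2 (abs_besselJ_le_one 0 t)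
      have h3 : besselJ 1 t ^ 2 ≤ 1 := (sq_le_one_iff_abs_le_one _).2 (abs_besselJ_le_one 1 t)
      have h4 : t * (besselJ 0 t ^ 2 + besselJ 1 t ^ 2) ≤ 1 * 2 :=
        mul_le_mul h1 (by linarith) (by positivity) one_pos.le
      linarith [abs_nonneg (V 1)]
  refine ⟨2 * |V 1| + 2, fun t => ?_⟩
  rcases abs_cases t with ⟨h, ht⟩ | ⟨h, ht⟩
  · rw [h]
    exact hpos t ht
  · rw [h]
    have := hpos (-t) (by linarith)
    rwa [besselJ_zero_neg, besselJ_one_neg, neg_sq] at this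

/-! ### Convergence of the improper integrals. -/

/-- An improper integral converges if, up to an error of order `s⁻²`, the integrand is the
derivative of a function with a limit at infinity. -/
theorem improperConvergent_of_hasDerivAt {f F e : ℝ → ℝ} {C l : ℝ} (hf : Continuous f)
    (hF : ∀ s, 1 ≤ s → HasDerivAt F (f s - e s) s) (hlim : Tendsto F atTop (𝓝 l))
    (he : ContinuousOn e (Set.Ici 1)) (hbound : ∀ s, 1 ≤ s → |e s| ≤ C / s ^ 2) :
    ImproperConvergent f := by
  have hint : IntegrableOn e (Set.Ioi 1) := by
    have hdom : IntegrableOn (fun s : ℝ => C * s ^ (-2 : ℝ)) (Set.Ioi 1) :=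
      (integrableOn_Ioi_rpow_of_lt (by norm_num) one_pos).const_mul C
    refine Integrable.mono' hdom
      ((he.mono Set.Ioi_subset_Ici_self).aestronglyMeasurable measurableSet_Ioi) ?_
    refine (ae_restrict_iff' measurableSet_Ioi).2 (ae_of_all _ fun s hs => ?_)
    have hs1 : (1 : ℝ) < s := hs
    have := hbound s hs1.le
    rwa [Real.rpow_neg (by linarith), Real.rpow_two, ← div_eq_mul_inv, Real.norm_eq_abs]
  have htail := intervalIntegral_tendsto_integral_Ioi (1 : ℝ) hint tendsto_id
  refine ⟨(∫ s in (0 : ℝ)..1, f s) + ((l - F 1) + ∫ s in Set.Ioi (1 : ℝ), e s), ?_⟩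
  have hmain : Tendsto (fun T : ℝ => (∫ s in (0 : ℝ)..1, f s) +
      ((F T - F 1) + ∫ s in (1 : ℝ)..id T, e s)) atTop
      (𝓝 ((∫ s in (0 : ℝ)..1, f s) + ((l - F 1) + ∫ s in Set.Ioi (1 : ℝ), e s))) :=
    ((hlim.sub_const _).add htail).const_add _
  refine hmain.congr' ?_
  filter_upwards [eventually_ge_atTop 1] with T hT
  have hei : IntervalIntegrable e volume 1 T := by
    apply ContinuousOn.intervalIntegrable
    rw [Set.uIcc_of_le hT]
    exact he.mono Set.Icc_subset_Ici_self
  have hFTC := intervalIntegral.integral_eq_sub_of_hasDerivAt (a := 1) (b := T)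
    (f := F) (f' := fun s => f s - e s)
    (fun s hs => hF s (by rw [Set.uIcc_of_le hT] at hs; exact hs.1))
    ((hf.intervalIntegrable _ _).sub hei)
  rw [intervalIntegral.integral_sub (hf.intervalIntegrable _ _) hei] at hFTC
  rw [← intervalIntegral.integral_add_adjacent_intervals (hf.intervalIntegrable 0 1)
    (hf.intervalIntegrable 1 T), ← hFTC, id]
  ring

theorem improperConvergent_of_abs_le {f : ℝ → ℝ} {C : ℝ} (hf : Continuous f)
    (hbound : ∀ s, 1 ≤ s → |f s| ≤ C / s ^ 2) : ImproperConvergent f :=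
  improperConvergent_of_hasDerivAt (F := fun _ => 0) (e := f) (l := 0) hf
    (fun s _ => by simpa using hasDerivAt_const s (0 : ℝ)) tendsto_const_nhds hf.continuousOn hbound

theorem abs_prod_erase_le {n : ℕ} {φ : Fin n → ℝ} (hφ : ∀ i, |φ i| ≤ 1) (k : Fin n) :
    |∏ i ∈ Finset.univ.erase k, φ i| ≤ 1 := by
  rw [Finset.abs_prod]
  exact Finset.prod_le_one (fun i _ => abs_nonneg _) (fun i _ => hφ i)

theorem abs_prod_erase_le_mul {n : ℕ} {φ : Fin n → ℝ} (hφ : ∀ i, |φ i| ≤ 1) {k i j : Fin n}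
    (hik : i ≠ k) (hjk : j ≠ k) (hij : i ≠ j) :
    |∏ i ∈ Finset.univ.erase k, φ i| ≤ |φ i| * |φ j| := by
  have hi : i ∈ Finset.univ.erase k := by simp [hik]
  have hj : j ∈ (Finset.univ.erase k).erase i := by simp [hjk, hij.symm]
  rw [Finset.abs_prod, ← Finset.mul_prod_erase _ _ hi, ← Finset.mul_prod_erase _ _ hj, ← mul_assoc]
  exact mul_le_of_le_one_right (by positivity)
    (Finset.prod_le_one (fun i _ => abs_nonneg _) (fun i _ => hφ i))

theorem prod_erase_eq_single {n : ℕ} {φ : Fin n → ℝ} {k j : Fin n} (hjk : j ≠ k)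
    (h : ∀ i, i ≠ k → i ≠ j → φ i = 1) : ∏ i ∈ Finset.univ.erase k, φ i = φ j := by
  refine Finset.prod_eq_single j (fun i hi hij => h i (Finset.ne_of_mem_erase hi) hij) ?_
  intro hj
  simp [hjk] at hj

theorem continuous_integrandReal {n : ℕ} (a : EuclideanSpace ℝ (Fin n)) (k : Fin n) :
    Continuous (integrandReal a k) := by
  have := Real.continuous_sinc
  unfold integrandReal
  fun_prop

theorem abs_integrandReal_le {n : ℕ} (a : EuclideanSpace ℝ (Fin n)) (k : Fin n) (s : ℝ) :
    |integrandReal a k s| ≤ 1 := by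
  rw [integrandReal, abs_mul]
  exact mul_le_one₀ (abs_prod_erase_le (fun i => Real.abs_sinc_le_one _) k) (abs_nonneg _)
    (Real.abs_cos_le_one _)

theorem exists_bounded_primitive_sin (c : ℝ) :
    ∃ P : ℝ → ℝ, (∀ s, HasDerivAt P (Real.sin (c * s)) s) ∧ ∃ M, ∀ s, |P s| ≤ M := by
  rcases eq_or_ne c 0 with rfl | hc
  · exact ⟨fun _ => 0, fun s => by simpa using hasDerivAt_const s (0 : ℝ), 0, by simp⟩
  · refine ⟨fun s => -Real.cos (c * s) / c, fun s => ?_, 1 / |c|, fun s => ?_⟩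
    · have := (((hasDerivAt_id s).const_mul c).cos.neg).div_const c
      convert! this using 1
      simp only [id]
      field_simp
    · rw [abs_div, abs_neg]
      gcongr
      exact Real.abs_cos_le_one _

theorem abs_sinc_mul_le {α s : ℝ} (hα : α ≠ 0) (hs : 0 < s) :
    |Real.sinc (α * s)| ≤ 1 / |α| / s := by
  rw [Real.sinc_of_ne_zero (mul_ne_zero hα hs.ne'), abs_div, abs_mul, abs_of_pos hs, div_div]
  gcongr
  exact Real.abs_sin_le_one _

theorem improperConvergent_sinc_mul_cos {α : ℝ} (hα : α ≠ 0) (β : ℝ) :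
    ImproperConvergent (fun s => Real.sinc (α * s) * Real.cos (β * s)) := by
  obtain ⟨P, hP, M, hM⟩ := exists_bounded_primitive_sin (α + β)
  obtain ⟨Q, hQ, N, hN⟩ := exists_bounded_primitive_sin (α - β)
  have hPc : Continuous P := continuous_iff_continuousAt.2 fun s => (hP s).continuousAt
  have hQc : Continuous Q := continuous_iff_continuousAt.2 fun s => (hQ s).continuousAt
  have hb : ∀ s, |(P s + Q s) / (2 * α)| ≤ (M + N) / |2 * α| := by
    intro s
    rw [abs_div]
    gcongr
    exact (abs_add_le _ _).trans (add_le_add (hM s) (hN s))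
  -- By the product-to-sum formula, `P + Q` is a bounded primitive of `2 sin (α s) cos (β s)`.
  -- Dividing it by `2 α s` gives a primitive of the integrand up to `(P + Q) / (2 α s²)`. A zero
  -- frequency `α ± β` is harmless, since then the sine vanishes identically.
  refine improperConvergent_of_hasDerivAt (F := fun s => (P s + Q s) / (2 * α) / s)
    (e := fun s => (P s + Q s) / (2 * α) / s ^ 2) (l := 0) (C := (M + N) / |2 * α|)
    ?_ ?_ ?_ ?_ ?_
  · have := Real.continuous_sinc
    fun_prop
  · intro s hs
    have hs0 : s ≠ 0 := by linarith
    have h := (((hP s).add (hQ s)).div_const (2 * α)).div (hasDerivAt_id s) hs0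
    convert! h using 1
    rw [Real.sinc_of_ne_zero (mul_ne_zero hα hs0), add_mul, sub_mul, Real.sin_add, Real.sin_sub]
    simp only [id, Pi.add_apply]
    field_simp
    ring
  · exact tendsto_bdd_div_atTop_nhds_zero
      (Eventually.of_forall fun s => (abs_le.1 (hb s)).1)
      (Eventually.of_forall fun s => (abs_le.1 (hb s)).2) tendsto_id
  · refine ContinuousOn.div (by fun_prop) (by fun_prop) ?_
    intro s hs
    have : (1 : ℝ) ≤ s := hs
    positivity
  · intro s hs
    rw [abs_div, abs_pow, sq_abs]
    gcongr
    exact hb s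

theorem improperConvergent_integrandReal {n : ℕ} (a : EuclideanSpace ℝ (Fin n)) {k j : Fin n}
    (hjk : j ≠ k) (hj : a j ≠ 0) : ImproperConvergent (integrandReal a k) := by
  by_cases h : ∃ i, i ≠ k ∧ i ≠ j ∧ a i ≠ 0
  · obtain ⟨i, hik, hij, hi⟩ := h
    refine improperConvergent_of_abs_le (C := 1 / |a i| * (1 / |a j|))
      (continuous_integrandReal a k) fun s hs => ?_
    have hs0 : 0 < s := by linarith
    rw [integrandReal, abs_mul]
    refine (mul_le_of_le_one_right (abs_nonneg _) (Real.abs_cos_le_one _)).trans ?_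
    refine (abs_prod_erase_le_mul (φ := fun i => Real.sinc (a i * s))
      (fun i => Real.abs_sinc_le_one _) hik hjk hij).trans ?_
    calc _ ≤ 1 / |a i| / s * (1 / |a j| / s) := by
          gcongr
          · exact abs_sinc_mul_le hi hs0
          · exact abs_sinc_mul_le hj hs0
      _ = _ := by rw [div_mul_div_comm, sq]
  · push Not at h
    have heq : integrandReal a k = fun s => Real.sinc (a j * s) * Real.cos (a k * s) := by
      funext s
      rw [integrandReal, prod_erase_eq_single (φ := fun i => Real.sinc (a i * s)) hjk
        (fun i hik hij => by simp [h i hik hij])]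
    rw [heq]
    exact improperConvergent_sinc_mul_cos hj _

/-- `jOne` is twice the difference quotient of `J₁` at `0`; the value `1` at `0` matches `J₁'(0) =
1/2`. -/
theorem continuous_jOne : Continuous jOne := by
  have hd : deriv (besselJ 1) 0 = 1 / 2 := by
    rw [(hasDerivAt_besselJ_one_aux 0).deriv]
    simp only [zero_mul, Real.cos_zero, mul_one, integral_sin_sq, Real.sin_zero, Real.sin_pi,
      sub_zero, zero_add]
    have := Real.pi_ne_zero
    field_simp
  have heq : jOne = fun t => 2 * dslope (besselJ 1) 0 t := by
    funext t
    rcases eq_or_ne t 0 with rfl | ht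
    · simp [jOne, hd]
    · rw [dslope_of_ne _ ht, slope_def_field, besselJ_one_zero, jOne, if_neg ht]
      ring
  rw [heq]
  refine continuous_const.mul (continuous_iff_continuousAt.2 fun t => ?_)
  rcases eq_or_ne t 0 with rfl | ht
  · exact continuousAt_dslope_same.2 (hasDerivAt_besselJ_one_aux 0).differentiableAt
  · exact (continuousAt_dslope_of_ne ht).2 continuous_besselJ_one.continuousAt

theorem jOne_mul_self (t : ℝ) : jOne t * t = 2 * besselJ 1 t := by
  rcases eq_or_ne t 0 with rfl | ht
  · simp [besselJ_one_zero]
  · rw [jOne, if_neg ht, div_mul_cancel₀ _ ht]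

theorem abs_jOne_le_one (t : ℝ) : |jOne t| ≤ 1 := by
  rcases eq_or_ne t 0 with rfl | ht
  · simp [jOne]
  · rw [jOne, if_neg ht, abs_div, abs_mul, abs_two, div_le_one (abs_pos.2 ht)]
    linarith [abs_besselJ_one_le t]

theorem jOne_neg (t : ℝ) : jOne (-t) = jOne t := by
  simp [jOne, besselJ_one_neg]

theorem continuous_integrandComplex {n : ℕ} (a : EuclideanSpace ℝ (Fin n)) (k : Fin n) :
    Continuous (integrandComplex a k) := by
  have := continuous_jOne
  have := continuous_besselJ_zero
  unfold integrandComplex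
  fun_prop

theorem abs_integrandComplex_le {n : ℕ} (a : EuclideanSpace ℝ (Fin n)) (k : Fin n) (s : ℝ) :
    |integrandComplex a k s| ≤ |s| := by
  rw [integrandComplex, abs_mul, abs_mul]
  exact mul_le_of_le_one_left (abs_nonneg _)
    (mul_le_one₀ (abs_prod_erase_le (fun i => abs_jOne_le_one _) k) (abs_nonneg _)
      (abs_besselJ_le_one _ _))

theorem exists_mul_besselJ_one_sq_le (α : ℝ) :
    ∃ C, ∀ s, 0 < s → s * besselJ 1 (α * s) ^ 2 ≤ C := by
  rcases eq_or_ne α 0 with rfl | hα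
  · exact ⟨0, fun s _ => by simp [besselJ_one_zero]⟩
  · obtain ⟨C, hC⟩ := exists_abs_mul_besselJ_sq_add_sq_le
    refine ⟨C / |α|, fun s hs => ?_⟩
    rw [le_div_iff₀ (abs_pos.2 hα)]
    refine le_trans ?_ (hC (α * s))
    rw [abs_mul, abs_of_pos hs]
    nlinarith [mul_nonneg (mul_nonneg (abs_nonneg α) hs.le) (sq_nonneg (besselJ 0 (α * s)))]

/-- Each factor is `O(s^(-1/2))`; the arithmetic-geometric mean inequality combines the two squared
bounds. -/
theorem exists_abs_besselJ_one_mul_le (α β : ℝ) :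
    ∃ C, ∀ s, 0 < s → |besselJ 1 (α * s) * besselJ 1 (β * s)| ≤ C / s := by
  obtain ⟨C, hC⟩ := exists_mul_besselJ_one_sq_le α
  obtain ⟨D, hD⟩ := exists_mul_besselJ_one_sq_le β
  refine ⟨(C + D) / 2, fun s hs => ?_⟩
  rw [le_div_iff₀ hs, abs_mul]
  have h1 := hC s hs
  have h2 := hD s hs
  rw [← sq_abs] at h1 h2
  nlinarith [mul_nonneg hs.le
    (sq_nonneg (|besselJ 1 (α * s)| - |besselJ 1 (β * s)|))]

theorem tendsto_sq_of_abs_mul_le {u : ℝ → ℝ} {C : ℝ} (h : ∀ t, |t| * u t ^ 2 ≤ C) {α : ℝ}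
    (hα : α ≠ 0) : Tendsto (fun s => u (α * s)) atTop (𝓝 0) := by
  have hsq : Tendsto (fun s => u (α * s) ^ 2) atTop (𝓝 0) := by
    refine squeeze_zero' (g := fun s => C / |α| / s)
      (Eventually.of_forall fun s => sq_nonneg _) ?_ (tendsto_const_nhds.div_atTop tendsto_id)
    filter_upwards [eventually_gt_atTop 0] with s hs
    have := h (α * s)
    rw [abs_mul, abs_of_pos hs] at this
    rw [div_div, le_div_iff₀ (by positivity)]
    linarith
  have := hsq.sqrt
  simp only [Real.sqrt_sq_eq_abs, Real.sqrt_zero] at this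
  exact (tendsto_zero_iff_abs_tendsto_zero _).2 this

theorem tendsto_besselJ_zero {α : ℝ} (hα : α ≠ 0) :
    Tendsto (fun s => besselJ 0 (α * s)) atTop (𝓝 0) := by
  obtain ⟨C, hC⟩ := exists_abs_mul_besselJ_sq_add_sq_le
  exact tendsto_sq_of_abs_mul_le (C := C) (fun t => le_trans (mul_le_mul_of_nonneg_left
    (by linarith [sq_nonneg (besselJ 1 t)]) (abs_nonneg t)) (hC t)) hα

theorem tendsto_besselJ_one {α : ℝ} (hα : α ≠ 0) :
    Tendsto (fun s => besselJ 1 (α * s)) atTop (𝓝 0) := by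
  obtain ⟨C, hC⟩ := exists_abs_mul_besselJ_sq_add_sq_le
  exact tendsto_sq_of_abs_mul_le (C := C) (fun t => le_trans (mul_le_mul_of_nonneg_left
    (by linarith [sq_nonneg (besselJ 0 t)]) (abs_nonneg t)) (hC t)) hα

theorem hasDerivAt_besselJ_zero_mul (α s : ℝ) :
    HasDerivAt (fun s => besselJ 0 (α * s)) (-α * besselJ 1 (α * s)) s := by
  have := (hasDerivAt_besselJ_zero (α * s)).comp s ((hasDerivAt_id s).const_mul α)
  convert! this using 1
  ring

theorem hasDerivAt_besselJ_one_mul (α : ℝ) {s : ℝ} (hs : s ≠ 0) :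
    HasDerivAt (fun s => besselJ 1 (α * s)) (α * besselJ 0 (α * s) - besselJ 1 (α * s) / s) s := by
  rcases eq_or_ne α 0 with rfl | hα
  · simpa [besselJ_one_zero] using hasDerivAt_const s (0 : ℝ)
  · have := (hasDerivAt_besselJ_one (mul_ne_zero hα hs)).comp s ((hasDerivAt_id s).const_mul α)
    convert! this using 1
    field_simp

/-- Convergence of the Weber–Schafheitlin integral of `J₁(α s) J₀(β s)`. -/
theorem improperConvergent_besselJ_one_mul_besselJ_zero {α : ℝ} (hα : α ≠ 0) (β : ℝ) :
    ImproperConvergent (fun s => besselJ 1 (α * s) * besselJ 0 (β * s)) := by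
  have hc0 := continuous_besselJ_zero
  have hc1 := continuous_besselJ_one
  have hcont : Continuous (fun s => besselJ 1 (α * s) * besselJ 0 (β * s)) := by fun_prop
  by_cases h : β ^ 2 = α ^ 2
  · have heq : ∀ s, besselJ 0 (β * s) = besselJ 0 (α * s) := by
      intro s
      rcases sq_eq_sq_iff_eq_or_eq_neg.1 h with rfl | rfl
      · rfl
      · rw [neg_mul, besselJ_zero_neg]
    -- For `β = ±α` the integrand is an exact derivative, because `J₀' = -J₁`.
    refine improperConvergent_of_hasDerivAt (F := fun s => -(besselJ 0 (α * s) ^ 2) / (2 * α))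
      (e := fun _ => 0) (l := -(0 ^ 2) / (2 * α)) (C := 0) hcont ?_ ?_ continuousOn_const (by simp)
    · intro s _
      have := ((hasDerivAt_besselJ_zero_mul α s).pow 2).neg.div_const (2 * α)
      convert! this using 1
      rw [heq]
      field_simp
      ring
    · exact ((tendsto_besselJ_zero hα).pow 2).neg.div_const _
  · have hd : β ^ 2 - α ^ 2 ≠ 0 := sub_ne_zero.2 h
    obtain ⟨C, hC⟩ := exists_abs_besselJ_one_mul_le α β
    -- For `β² ≠ α²` the terms `J₀(α s) J₁(β s)` cancel in the derivative of this combination. What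
    -- remains is the integrand plus a multiple of `J₁(α s) J₁(β s) / s`, which is `O(s⁻²)`.
    refine improperConvergent_of_hasDerivAt
      (F := fun s => (α * (besselJ 0 (α * s) * besselJ 0 (β * s)) +
        β * (besselJ 1 (α * s) * besselJ 1 (β * s))) / (β ^ 2 - α ^ 2))
      (e := fun s => 2 * β / (β ^ 2 - α ^ 2) * ((besselJ 1 (α * s) * besselJ 1 (β * s)) / s))
      (l := (α * 0 + β * 0) / (β ^ 2 - α ^ 2)) (C := |2 * β / (β ^ 2 - α ^ 2)| * C)
      hcont ?_ ?_ ?_ ?_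
    · intro s hs
      have hs0 : s ≠ 0 := by linarith
      have h0 := (hasDerivAt_besselJ_zero_mul α s).mul (hasDerivAt_besselJ_zero_mul β s)
      have h1 := (hasDerivAt_besselJ_one_mul α hs0).mul (hasDerivAt_besselJ_one_mul β hs0)
      have := ((h0.const_mul α).add (h1.const_mul β)).div_const (β ^ 2 - α ^ 2)
      convert! this using 1
      field_simp
      ring
    · have hb0 : ∀ s : ℝ, ‖besselJ 0 (β * s)‖ ≤ 1 := fun s => abs_besselJ_le_one _ _
      have hb1 : ∀ s : ℝ, ‖besselJ 1 (β * s)‖ ≤ 1 := fun s => abs_besselJ_le_one _ _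
      have l0 := (tendsto_besselJ_zero hα).zero_mul_isBoundedUnder_le
        (isBoundedUnder_of ⟨1, hb0⟩)
      have l1 := (tendsto_besselJ_one hα).zero_mul_isBoundedUnder_le
        (isBoundedUnder_of ⟨1, hb1⟩)
      exact ((l0.const_mul α).add (l1.const_mul β)).div_const _
    · refine continuousOn_const.mul (ContinuousOn.div (by fun_prop) (by fun_prop) ?_)
      intro s hs
      have : (1 : ℝ) ≤ s := hs
      positivity
    · intro s hs
      have hs0 : 0 < s := by linarith
      have h3 : |besselJ 1 (α * s) * besselJ 1 (β * s) / s| ≤ C / s ^ 2 := by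
        rw [abs_div, abs_of_pos hs0, sq, ← div_div]
        gcongr
        exact hC s hs0
      calc _ = |2 * β / (β ^ 2 - α ^ 2)| * |besselJ 1 (α * s) * besselJ 1 (β * s) / s| :=
            abs_mul _ _
        _ ≤ |2 * β / (β ^ 2 - α ^ 2)| * (C / s ^ 2) :=
            mul_le_mul_of_nonneg_left h3 (abs_nonneg _)
        _ = _ := by ring

theorem improperConvergent_integrandComplex {n : ℕ} (a : EuclideanSpace ℝ (Fin n)) {k j : Fin n}
    (hjk : j ≠ k) (hj : a j ≠ 0) : ImproperConvergent (integrandComplex a k) := by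
  by_cases h : ∃ i, i ≠ k ∧ i ≠ j ∧ a i ≠ 0
  · obtain ⟨i, hik, hij, hi⟩ := h
    obtain ⟨C, hC⟩ := exists_abs_besselJ_one_mul_le (a i) (a j)
    refine improperConvergent_of_abs_le (C := 4 / |a i * a j| * C)
      (continuous_integrandComplex a k) fun s hs => ?_
    have hs0 : 0 < s := by linarith
    rw [integrandComplex, abs_mul, abs_mul, abs_of_pos hs0]
    have h1 := mul_le_of_le_one_right
      (abs_nonneg (∏ j ∈ Finset.univ.erase k, jOne (a j * s))) (abs_besselJ_le_one 0 (a k * s))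
    have h2 := h1.trans (abs_prod_erase_le_mul (φ := fun i => jOne (a i * s))
      (fun i => abs_jOne_le_one _) hik hjk hij)
    refine (mul_le_mul_of_nonneg_right h2 hs0.le).trans ?_
    have e1 := jOne_mul_self (a i * s)
    have e2 := jOne_mul_self (a j * s)
    -- Two `jOne` factors supply `s⁻²` times a product of two `J₁`. The weight `s` uses up one
    -- power, and the decay of `J₁` restores it.
    have hprod : |jOne (a i * s)| * |jOne (a j * s)| * s =
        4 / |a i * a j| * (|besselJ 1 (a i * s) * besselJ 1 (a j * s)| / s) := by
      have e3 : jOne (a i * s) * jOne (a j * s) * (a i * a j) * s ^ 2 =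
          4 * (besselJ 1 (a i * s) * besselJ 1 (a j * s)) := by
        linear_combination (jOne (a j * s) * (a j * s)) * e1 + 2 * besselJ 1 (a i * s) * e2
      have e4 := congrArg abs e3
      rw [abs_mul, abs_mul, abs_mul, abs_mul 4, abs_pow, sq_abs,
        abs_of_pos (by norm_num : (0 : ℝ) < 4)] at e4
      have hij' : |a i * a j| ≠ 0 := abs_ne_zero.2 (mul_ne_zero hi hj)
      rw [div_mul_div_comm, eq_div_iff (by positivity)]
      linear_combination e4
    have h3 : |besselJ 1 (a i * s) * besselJ 1 (a j * s)| / s ≤ C / s ^ 2 := by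
      rw [sq, ← div_div]
      gcongr
      exact hC s hs0
    calc _ = 4 / |a i * a j| * (|besselJ 1 (a i * s) * besselJ 1 (a j * s)| / s) := hprod
      _ ≤ 4 / |a i * a j| * (C / s ^ 2) := mul_le_mul_of_nonneg_left h3 (by positivity)
      _ = _ := by ring
  · push Not at h
    have heq : integrandComplex a k =
        fun s => 2 / a j * (besselJ 1 (a j * s) * besselJ 0 (a k * s)) := by
      funext s
      rw [integrandComplex, prod_erase_eq_single (φ := fun i => jOne (a i * s)) hjk
        (fun i hik hij => by simp [h i hik hij, jOne])]
      have e : jOne (a j * s) * s = 2 / a j * besselJ 1 (a j * s) := by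
        rw [div_mul_eq_mul_div, eq_div_iff hj]
        linear_combination jOne_mul_self (a j * s)
      linear_combination besselJ 0 (a k * s) * e
    obtain ⟨L, hL⟩ := improperConvergent_besselJ_one_mul_besselJ_zero hj (a k)
    refine ⟨2 / a j * L, ?_⟩
    rw [heq]
    unfold HasImproperIntegral at hL ⊢
    simp only [intervalIntegral.integral_const_mul]
    exact hL.const_mul _

/-! ### Gaussian summability. -/

/-- Gaussian summation of a convergent improper integral. -/
theorem HasImproperIntegral.tendsto_integral_mul_gaussian {f : ℝ → ℝ} {L : ℝ}
    (h : HasImproperIntegral f L) (hf : Continuous f) (hb : ∀ s, |f s| ≤ 1 + |s|) {c : ℕ → ℝ}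
    (hc : ∀ n, 0 < c n) (hc0 : Tendsto c atTop (𝓝 0)) :
    Tendsto (fun n => ∫ s in Set.Ioi (0 : ℝ), f s * Real.exp (-(c n * s) ^ 2)) atTop (𝓝 L) := by
  let P : ℝ → ℝ := fun T => ∫ s in (0 : ℝ)..T, f s
  have hP : ∀ T, HasDerivAt P (f T) T := fun T =>
    intervalIntegral.integral_hasDerivAt_right (hf.intervalIntegrable _ _)
      (hf.stronglyMeasurableAtFilter _ _) hf.continuousAt
  have hPc : Continuous P := continuous_iff_continuousAt.2 fun s => (hP s).continuousAt
  have hPL : Tendsto P atTop (𝓝 L) := h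
  obtain ⟨M, hM⟩ : ∃ M, ∀ s, 0 ≤ s → |P s| ≤ M := by
    obtain ⟨T, hT⟩ := eventually_atTop.1 (hPL.abs.eventually (gt_mem_nhds (lt_add_one |L|)))
    obtain ⟨M, hM⟩ := (isCompact_Icc (a := (0 : ℝ)) (b := T)).exists_bound_of_continuousOn
      hPc.continuousOn
    refine ⟨max M (|L| + 1), fun s hs => ?_⟩
    rcases le_total s T with h1 | h1
    · exact le_max_of_le_left (hM s ⟨hs, h1⟩)
    · exact le_max_of_le_right (hT s h1).le
  have hgauss : IntegrableOn (fun v : ℝ => 2 * v * Real.exp (-v ^ 2)) (Set.Ioi 0) := by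
    have := (integrable_mul_exp_neg_mul_sq one_pos).const_mul 2
    simp only [neg_mul, one_mul, ← mul_assoc] at this
    exact this.integrableOn
  -- Integration by parts trades `f` for its primitive `P`, and `v = c s` fixes the weight as the
  -- probability density `2 v exp (-v²)`. `P` is bounded on the half-line and `P (v / c) → L`, so
  -- dominated convergence applies although `f` need not be integrable.
  have hparts : ∀ n, ∫ s in Set.Ioi (0 : ℝ), f s * Real.exp (-(c n * s) ^ 2) =
      ∫ v in Set.Ioi (0 : ℝ), P ((c n)⁻¹ * v) * (2 * v * Real.exp (-v ^ 2)) := by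
    intro n
    have hcn := hc n
    have hV : ∀ s, HasDerivAt (fun s => Real.exp (-(c n * s) ^ 2))
        (-(c n * (2 * (c n * s) * Real.exp (-(c n * s) ^ 2)))) s := by
      intro s
      have := ((((hasDerivAt_id s).const_mul (c n)).pow 2).neg).exp
      convert! this using 1
      simp only [id, Pi.neg_apply, Pi.pow_apply]
      ring
    have hdom : Integrable (fun s : ℝ => P s * (-(c n * (2 * (c n * s) *
        Real.exp (-(c n * s) ^ 2))))) (volume.restrict (Set.Ioi 0)) := by
      have h1 := (integrable_mul_exp_neg_mul_sq (b := c n ^ 2) (by positivity)).const_mul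
        (-(2 * c n ^ 2))
      have h2 := (h1.integrableOn (s := Set.Ioi 0)).bdd_mul (c := M) hPc.aestronglyMeasurable
        ((ae_restrict_iff' measurableSet_Ioi).2 (ae_of_all _ fun s hs => hM s (le_of_lt hs)))
      refine h2.congr (ae_of_all _ fun s => ?_)
      simp only [mul_pow, neg_mul]
      ring
    have hint : Integrable (fun s : ℝ => f s * Real.exp (-(c n * s) ^ 2)) := by
      have h1 := integrable_exp_neg_mul_sq (b := c n ^ 2) (by positivity)
      have h2 := (integrable_mul_exp_neg_mul_sq (b := c n ^ 2) (by positivity)).norm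
      refine Integrable.mono' (h1.add h2)
        (by apply Continuous.aestronglyMeasurable; fun_prop) (ae_of_all _ fun s => ?_)
      simp only [Pi.add_apply, norm_mul, Real.norm_eq_abs, Real.abs_exp, ← one_add_mul]
      rw [mul_pow, neg_mul]
      exact mul_le_mul_of_nonneg_right (hb s) (Real.exp_pos _).le
    have hlim : Tendsto (fun s => P s * Real.exp (-(c n * s) ^ 2)) atTop (𝓝 (L * 0)) := by
      refine hPL.mul (Real.tendsto_exp_atBot.comp (tendsto_neg_atTop_atBot.comp ?_))
      exact (tendsto_pow_atTop two_ne_zero).comp (tendsto_id.const_mul_atTop hcn)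
    have hzero : Tendsto (fun s => P s * Real.exp (-(c n * s) ^ 2)) (𝓝[>] 0) (𝓝 0) := by
      have : Continuous fun s => P s * Real.exp (-(c n * s) ^ 2) := by fun_prop
      have h0 := (this.tendsto 0).mono_left (nhdsWithin_le_nhds (s := Set.Ioi 0))
      simpa [P] using h0
    have hIBP := integral_Ioi_mul_deriv_eq_deriv_mul (a := (0 : ℝ)) (u := P) (u' := f)
      (v := fun s => Real.exp (-(c n * s) ^ 2)) (fun s _ => hP s) (fun s _ => hV s)
      hdom hint.integrableOn hzero hlim
    have hsub := integral_comp_mul_left_Ioi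
      (fun v => P ((c n)⁻¹ * v) * (2 * v * Real.exp (-v ^ 2))) 0 hcn
    rw [mul_zero, smul_eq_mul, eq_inv_mul_iff_mul_eq₀ hcn.ne', ← integral_const_mul] at hsub
    rw [← hsub]
    have : ∀ s, c n * (P ((c n)⁻¹ * (c n * s)) * (2 * (c n * s) * Real.exp (-(c n * s) ^ 2))) =
        -(P s * (-(c n * (2 * (c n * s) * Real.exp (-(c n * s) ^ 2))))) := by
      intro s
      rw [inv_mul_cancel_left₀ hcn.ne']
      ring
    simp only [this]
    rw [integral_neg, hIBP]
    ring
  simp only [hparts]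
  have htot : ∫ v in Set.Ioi (0 : ℝ), L * (2 * v * Real.exp (-v ^ 2)) = L := by
    rw [integral_const_mul]
    have hd : ∀ v ∈ Set.Ici (0 : ℝ), HasDerivAt (fun v => -Real.exp (-v ^ 2))
        (2 * v * Real.exp (-v ^ 2)) v := by
      intro v _
      have := ((((hasDerivAt_id v).pow 2).neg).exp).neg
      convert! this using 1
      simp only [id, Pi.neg_apply, Pi.pow_apply]
      ring
    have ht : Tendsto (fun v : ℝ => -Real.exp (-v ^ 2)) atTop (𝓝 (-0)) :=
      (Real.tendsto_exp_atBot.comp (tendsto_neg_atTop_atBot.comp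
        (tendsto_pow_atTop two_ne_zero))).neg
    rw [integral_Ioi_of_hasDerivAt_of_tendsto' hd hgauss ht]
    simp
  rw [← htot]
  refine tendsto_integral_of_dominated_convergence (fun v => M * (2 * v * Real.exp (-v ^ 2)))
    (fun n => by apply Continuous.aestronglyMeasurable; fun_prop) (hgauss.const_mul M)
    (fun n => (ae_restrict_iff' measurableSet_Ioi).2 (ae_of_all _ fun v hv => ?_))
    ((ae_restrict_iff' measurableSet_Ioi).2 (ae_of_all _ fun v hv => ?_))
  · have hv0 : (0 : ℝ) < v := hv
    have hcn := hc n
    have hnn : 0 ≤ 2 * v * Real.exp (-v ^ 2) := by positivity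
    rw [norm_mul, Real.norm_of_nonneg hnn]
    exact mul_le_mul_of_nonneg_right (hM _ (by positivity)) hnn
  · have hinv : Tendsto (fun n => (c n)⁻¹) atTop atTop :=
      tendsto_inv_nhdsGT_zero.comp
        (tendsto_nhdsWithin_iff.2 ⟨hc0, Eventually.of_forall hc⟩)
    exact (hPL.comp (hinv.atTop_mul_const hv)).mul_const _

/-! ### Averaging over balls preserves radial monotonicity. -/

section Radial

variable {F : Type*} [NormedAddCommGroup F] [InnerProductSpace ℝ F]

/-- The value of `h` does not increase when the norm of the argument increases. -/
def RadiallyDecreasing (h : F → ENNReal) : Prop := ∀ x y, ‖x‖ ≤ ‖y‖ → h y ≤ h x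

/-- The reflection that exchanges `x` and `y`. -/
noncomputable def swapReflection (x y w : F) : F :=
  w - (2 * (inner ℝ (y - x) (w - (2⁻¹ : ℝ) • (x + y)) / ‖y - x‖ ^ 2)) • (y - x)

/-- The common source of the distance identities for the reflection in the perpendicular bisector of
`x` and `y`; it is used with `p = x`, `p = y` and `p = 0`. -/
theorem norm_swapReflection_sub_sq {x y : F} (hxy : x ≠ y) (w p : F) :
    ‖swapReflection x y w - p‖ ^ 2 = ‖w - p‖ ^ 2 +
      4 * (inner ℝ (y - x) (w - (2⁻¹ : ℝ) • (x + y)) / ‖y - x‖ ^ 2) *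
        inner ℝ (y - x) (p - (2⁻¹ : ℝ) • (x + y)) := by
  have hv : ‖y - x‖ ≠ 0 := norm_ne_zero_iff.2 (sub_ne_zero.2 hxy.symm)
  set v := y - x
  set m := (2⁻¹ : ℝ) • (x + y)
  have e1 : swapReflection x y w - p = (w - p) - (2 * (inner ℝ v (w - m) / ‖v‖ ^ 2)) • v := by
    simp only [swapReflection, v, m]
    abel
  have e2 : inner ℝ v (w - p) = inner ℝ v (w - m) - inner ℝ v (p - m) := by
    rw [← inner_sub_right, sub_sub_sub_cancel_right]
  rw [e1, norm_sub_sq_real, norm_smul, mul_pow, Real.norm_eq_abs, sq_abs, inner_smul_right,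
    real_inner_comm v (w - p), e2]
  field_simp
  ring

theorem norm_swapReflection_sub_left {x y : F} (hxy : x ≠ y) (w : F) :
    ‖swapReflection x y w - x‖ = ‖w - y‖ := by
  have hv : ‖y - x‖ ≠ 0 := norm_ne_zero_iff.2 (sub_ne_zero.2 hxy.symm)
  rw [← sq_eq_sq₀ (norm_nonneg _) (norm_nonneg _), norm_swapReflection_sub_sq hxy]
  set v := y - x with hvdef
  set m := (2⁻¹ : ℝ) • (x + y) with hm
  have e1 : x - m = (-2⁻¹ : ℝ) • v := by
    rw [hm, hvdef]; module
  have e2 : w - x = (w - m) + (2⁻¹ : ℝ) • v := by rw [hm, hvdef]; module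
  have e3 : w - y = (w - m) - (2⁻¹ : ℝ) • v := by rw [hm, hvdef]; module
  clear_value v m
  rw [e1, e2, e3, norm_sub_sq_real, norm_add_sq_real, inner_smul_right, inner_smul_right,
    real_inner_self_eq_norm_sq, real_inner_comm v (w - m)]
  field_simp
  ring

theorem norm_swapReflection_sub_right {x y : F} (hxy : x ≠ y) (w : F) :
    ‖swapReflection x y w - y‖ = ‖w - x‖ := by
  have hv : ‖y - x‖ ≠ 0 := norm_ne_zero_iff.2 (sub_ne_zero.2 hxy.symm)
  rw [← sq_eq_sq₀ (norm_nonneg _) (norm_nonneg _), norm_swapReflection_sub_sq hxy]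
  set v := y - x with hvdef
  set m := (2⁻¹ : ℝ) • (x + y) with hm
  have e1 : y - m = (2⁻¹ : ℝ) • v := by
    rw [hm, hvdef]; module
  have e2 : w - x = (w - m) + (2⁻¹ : ℝ) • v := by rw [hm, hvdef]; module
  have e3 : w - y = (w - m) - (2⁻¹ : ℝ) • v := by rw [hm, hvdef]; module
  clear_value v m
  rw [e1, e2, e3, norm_sub_sq_real, norm_add_sq_real, inner_smul_right, inner_smul_right,
    real_inner_self_eq_norm_sq, real_inner_comm v (w - m)]
  field_simp
  ring

/-- Since `‖x‖ ≤ ‖y‖`, the origin lies on the `x` side of the bisector, while `w` lies on the `y`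
side. Reflecting `w` to the side of the origin cannot increase its distance from the origin. -/
theorem norm_swapReflection_le {x y w : F} (hxy : x ≠ y) (hle : ‖x‖ ≤ ‖y‖)
    (hw : ‖w - y‖ ≤ ‖w - x‖) : ‖swapReflection x y w‖ ≤ ‖w‖ := by
  have h := norm_swapReflection_sub_sq hxy w 0
  rw [sub_zero, sub_zero, zero_sub, inner_neg_right] at h
  rw [← sq_le_sq₀ (norm_nonneg _) (norm_nonneg _), h]
  have h1 : 0 ≤ inner ℝ (y - x) ((2⁻¹ : ℝ) • (x + y)) := by
    have : inner ℝ (y - x) ((2⁻¹ : ℝ) • (x + y)) = (‖y‖ ^ 2 - ‖x‖ ^ 2) / 2 := by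
      rw [inner_smul_right, inner_sub_left, inner_add_right, inner_add_right,
        real_inner_self_eq_norm_sq, real_inner_self_eq_norm_sq, real_inner_comm y x]
      ring
    rw [this]
    have := pow_le_pow_left₀ (norm_nonneg x) hle 2
    linarith
  have h2 : 0 ≤ inner ℝ (y - x) (w - (2⁻¹ : ℝ) • (x + y)) := by
    have : inner ℝ (y - x) (w - (2⁻¹ : ℝ) • (x + y)) = (‖w - x‖ ^ 2 - ‖w - y‖ ^ 2) / 2 := by
      rw [show w - x = (w - (2⁻¹ : ℝ) • (x + y)) + (2⁻¹ : ℝ) • (y - x) by module,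
        show w - y = (w - (2⁻¹ : ℝ) • (x + y)) - (2⁻¹ : ℝ) • (y - x) by module,
        norm_sub_sq_real, norm_add_sq_real, inner_smul_right,
        real_inner_comm (y - x) (w - (2⁻¹ : ℝ) • (x + y))]
      ring
    rw [this]
    have := pow_le_pow_left₀ (norm_nonneg _) hw 2
    linarith
  have h3 : 0 ≤ inner ℝ (y - x) (w - (2⁻¹ : ℝ) • (x + y)) / ‖y - x‖ ^ 2 := by positivity
  nlinarith [mul_nonneg h3 h1]

variable [FiniteDimensional ℝ F] [MeasurableSpace F] [BorelSpace F]

theorem measurePreserving_swapReflection (x y : F) :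
    MeasurePreserving (swapReflection x y) volume volume := by
  have h1 := measurePreserving_sub_right (volume : Measure F) ((2⁻¹ : ℝ) • (x + y))
  have h2 := ((Submodule.span ℝ {y - x})ᗮ.reflection).measurePreserving
  have h3 := measurePreserving_add_right (volume : Measure F) ((2⁻¹ : ℝ) • (x + y))
  convert! h3.comp (h2.comp h1) using 1
  funext w
  simp only [Function.comp_apply, Submodule.reflection_orthogonal_apply,
    Submodule.reflection_singleton_apply, swapReflection]
  simp only [RCLike.ofReal_real_eq_id, id]
  module

/-- The balls about `x` and `y` share their intersection, so only the two differences matter. The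
reflection exchanging `x` and `y` carries the difference on the `y` side onto the other one,
preserving volume and moving every point to one of no larger norm, where `h` is no smaller. -/
theorem RadiallyDecreasing.setLIntegral_closedBall {h : F → ENNReal} (hh : RadiallyDecreasing h)
    (hm : Measurable h) (r : ℝ) :
    RadiallyDecreasing (fun x => ∫⁻ z in Metric.closedBall 0 r, h (x + z)) := by
  have htrans : ∀ x, ∫⁻ z in Metric.closedBall 0 r, h (x + z) =
      ∫⁻ w in Metric.closedBall x r, h w := by
    intro x
    have := (measurePreserving_add_left (volume : Measure F) x).setLIntegral_comp_preimage
      (s := Metric.closedBall x r) Metric.isClosed_closedBall.measurableSet hm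
    rw [← this, preimage_add_closedBall]
    simp
  intro x y hxy
  simp only [htrans]
  rcases eq_or_ne x y with rfl | hne
  · rfl
  have mx : MeasurableSet (Metric.closedBall x r) := Metric.isClosed_closedBall.measurableSet
  have my : MeasurableSet (Metric.closedBall y r) := Metric.isClosed_closedBall.measurableSet
  rw [← lintegral_inter_add_sdiff h (Metric.closedBall y r) mx,
    ← lintegral_inter_add_sdiff h (Metric.closedBall x r) my, Set.inter_comm]
  refine add_le_add le_rfl ?_
  rw [← (measurePreserving_swapReflection x y).setLIntegral_comp_preimage (mx.diff my) hm]
  have hpre : swapReflection x y ⁻¹' (Metric.closedBall x r \ Metric.closedBall y r) =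
      Metric.closedBall y r \ Metric.closedBall x r := by
    ext w
    simp only [Set.mem_preimage, Set.mem_sdiff, Metric.mem_closedBall, dist_eq_norm,
      norm_swapReflection_sub_left hne, norm_swapReflection_sub_right hne]
  rw [hpre]
  refine setLIntegral_mono' (my.diff mx) fun w hw => hh _ _ (norm_swapReflection_le hne hxy ?_)
  simp only [Set.mem_sdiff, Metric.mem_closedBall, dist_eq_norm, not_le] at hw
  linarith [hw.1, hw.2]

theorem RadiallyDecreasing.setLIntegral_closedBall_smul {h : F → ENNReal}
    (hh : RadiallyDecreasing h) (hm : Measurable h) (r a : ℝ) :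
    RadiallyDecreasing (fun x => ∫⁻ z in Metric.closedBall 0 r, h (x + a • z)) := by
  intro x y hxy
  rcases eq_or_ne a 0 with rfl | ha
  · simp only [zero_smul, add_zero, lintegral_const]
    gcongr
    exact hh x y hxy
  · have hscale : RadiallyDecreasing (fun w => h (a • w)) := fun u v huv =>
      hh _ _ (by rw [norm_smul, norm_smul]; gcongr)
    have key := hscale.setLIntegral_closedBall (by fun_prop) r (a⁻¹ • x) (a⁻¹ • y)
      (by rw [norm_smul, norm_smul]; gcongr)
    simpa only [smul_add, smul_inv_smul₀ ha] using key

/-- The function `y ↦ E g(y + ∑ b_j Z_j)`, with `Z_j` independent and uniform on a ball (up to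
normalisation). -/
noncomputable def ballSmoothing (r : ℝ) {m : ℕ} (b : Fin m → ℝ) (g : F → ENNReal) (y : F) : ENNReal :=
  ∫⁻ z : Fin m → F, g (y + ∑ j, b j • z j)
    ∂Measure.pi (fun _ => volume.restrict (Metric.closedBall 0 r))

theorem measurable_ballSmoothing (r : ℝ) {m : ℕ} (b : Fin m → ℝ) {g : F → ENNReal}
    (hg : Measurable g) : Measurable (ballSmoothing r b g) := by
  unfold ballSmoothing
  apply Measurable.lintegral_prod_right'
    (f := fun p : F × (Fin m → F) => g (p.1 + ∑ j, b j • p.2 j))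
  fun_prop

/-- Fubini in the `k`-th summand. It drives the induction over the number of balls and also the
final comparison of the full sum with the sum without `k`. -/
theorem ballSmoothing_succAbove (r : ℝ) {m : ℕ} (b : Fin (m + 1) → ℝ) {g : F → ENNReal}
    (hg : Measurable g) (k : Fin (m + 1)) (y : F) :
    ballSmoothing r b g y = ∫⁻ z in Metric.closedBall 0 r,
      ballSmoothing r (fun j => b (k.succAbove j)) g (y + b k • z) := by
  have hmp := (measurePreserving_piFinSuccAbove
    (fun _ : Fin (m + 1) => volume.restrict (Metric.closedBall (0 : F) r)) k).symm
  unfold ballSmoothing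
  rw [← hmp.lintegral_comp_emb (MeasurableEquiv.measurableEmbedding _), lintegral_prod]
  · refine lintegral_congr fun z => lintegral_congr fun w => ?_
    have hins : (MeasurableEquiv.piFinSuccAbove (fun _ : Fin (m + 1) => F) k).symm (z, w) =
        k.insertNth (α := fun _ => F) z w := rfl
    rw [hins, Fin.sum_univ_succAbove _ k]
    simp [add_assoc]
  · apply Measurable.aemeasurable
    have : Measurable fun z : Fin (m + 1) → F => g (y + ∑ j, b j • z j) := by fun_prop
    exact this.comp (MeasurableEquiv.measurable _)

theorem RadiallyDecreasing.ballSmoothing {g : F → ENNReal} (hg : RadiallyDecreasing g)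
    (hm : Measurable g) (r : ℝ) {m : ℕ} (b : Fin m → ℝ) :
    RadiallyDecreasing (ballSmoothing r b g) := by
  induction m with
  | zero =>
    intro x y hxy
    simpa [CubeSection.ballSmoothing] using hg x y hxy
  | succ m ih =>
    intro x y hxy
    rw [ballSmoothing_succAbove r b hm 0, ballSmoothing_succAbove r b hm 0]
    exact (ih _).setLIntegral_closedBall_smul (measurable_ballSmoothing r _ hm) r (b 0) x y hxy

/-- Averaging over one more ball dominates the value on the boundary of that ball. -/
theorem ballSmoothing_succAbove_smul_le {g : F → ENNReal} (hg : RadiallyDecreasing g)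
    (hm : Measurable g) {r : ℝ} (hvol : volume (Metric.closedBall (0 : F) r) = 1) {m : ℕ}
    (b : Fin (m + 1) → ℝ) (k : Fin (m + 1)) {e : F} (he : ‖e‖ = r) :
    CubeSection.ballSmoothing r (fun j => b (k.succAbove j)) g (b k • e) ≤
      CubeSection.ballSmoothing r b g 0 := by
  rw [ballSmoothing_succAbove r b hm k]
  -- The ball has volume one, so a constant equals its integral over the ball and the comparison
  -- becomes pointwise.
  have hconst : CubeSection.ballSmoothing r (fun j => b (k.succAbove j)) g (b k • e) =
      ∫⁻ _ in Metric.closedBall (0 : F) r,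
        CubeSection.ballSmoothing r (fun j => b (k.succAbove j)) g (b k • e) := by
    rw [setLIntegral_const, hvol, mul_one]
  rw [hconst]
  refine setLIntegral_mono' Metric.isClosed_closedBall.measurableSet fun z hz => ?_
  refine hg.ballSmoothing hm r _ _ _ ?_
  rw [mem_closedBall_zero_iff] at hz
  rw [zero_add, norm_smul, norm_smul, he]
  gcongr

end Radial

/-! ### Fourier representation of the Gaussian-smoothed densities. -/

section Fourier

variable {F : Type*} [NormedAddCommGroup F] [InnerProductSpace ℝ F]

/-- The centred Gaussian density on `F` whose characteristic function is `exp (-c² ‖ξ‖²)`. -/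
noncomputable def gaussKernel (c : ℝ) (x : F) : ℝ :=
  ((2 * Real.pi) ^ Module.finrank ℝ F)⁻¹ * (Real.pi / c ^ 2) ^ (Module.finrank ℝ F / 2 : ℝ) *
    Real.exp (-‖x‖ ^ 2 / (4 * c ^ 2))

theorem gaussKernel_nonneg (c : ℝ) (x : F) : 0 ≤ gaussKernel c x := by
  have := Real.pi_pos
  unfold gaussKernel
  positivity

theorem continuous_gaussKernel (c : ℝ) : Continuous (gaussKernel c : F → ℝ) := by
  unfold gaussKernel
  fun_prop

theorem gaussKernel_le (c : ℝ) (x : F) : gaussKernel c x ≤ gaussKernel c (0 : F) := by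
  have := Real.pi_pos
  unfold gaussKernel
  gcongr
  simp

theorem radiallyDecreasing_gaussKernel (c : ℝ) :
    RadiallyDecreasing (fun x : F => ENNReal.ofReal (gaussKernel c x)) := by
  intro x y hxy
  have := Real.pi_pos
  refine ENNReal.ofReal_le_ofReal (mul_le_mul_of_nonneg_left (Real.exp_le_exp.2 ?_) (by positivity))
  gcongr

variable [FiniteDimensional ℝ F] [MeasurableSpace F] [BorelSpace F]

theorem ofReal_gaussKernel {c : ℝ} (hc : 0 < c) (x : F) : (gaussKernel c x : ℂ) =
    (((2 * Real.pi) ^ Module.finrank ℝ F)⁻¹ : ℝ) *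
      ∫ ξ : F, Complex.exp (-(c ^ 2 : ℝ) * ‖ξ‖ ^ 2 + Complex.I * inner ℝ x ξ) := by
  rw [GaussianFourier.integral_cexp_neg_mul_sq_norm_add (by rw [Complex.ofReal_re]; positivity)]
  have hpi := Real.pi_pos
  rw [gaussKernel, Complex.ofReal_mul, Complex.ofReal_mul, mul_assoc,
    Complex.ofReal_cpow (by positivity)]
  push_cast
  congr 3
  rw [Complex.I_sq]
  ring

theorem integrable_exp_neg_sq_mul_norm_sq {c : ℝ} (hc : 0 < c) :
    Integrable (fun ξ : F => Real.exp (-(c ^ 2 * ‖ξ‖ ^ 2))) := by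
  have h := (GaussianFourier.integrable_cexp_neg_mul_sq_norm_add (V := F) (b := (c ^ 2 : ℝ))
    (by rw [Complex.ofReal_re]; positivity) 0 0).norm
  refine h.congr (ae_of_all _ fun ξ => ?_)
  simp only [Complex.norm_exp]
  congr 1
  simp [← Complex.ofReal_pow]

/-- The kernel is itself a Gaussian Fourier integral, so Fubini replaces any inversion theorem. The
phase of a sum is a product of phases, and integration over the product measure gives a product of
characteristic functions. -/
theorem integral_pi_gaussKernel {c : ℝ} (hc : 0 < c) (ν : Measure F) [IsFiniteMeasure ν] {m : ℕ}
    (b : Fin m → ℝ) (y : F) :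
    ((∫ z : Fin m → F, gaussKernel c (y + ∑ j, b j • z j) ∂Measure.pi (fun _ => ν) : ℝ) : ℂ) =
      (((2 * Real.pi) ^ Module.finrank ℝ F)⁻¹ : ℝ) *
        ∫ ξ : F, Complex.exp (inner ℝ y ξ * Complex.I) *
          (Real.exp (-(c ^ 2 * ‖ξ‖ ^ 2)) * ∏ j, charFun ν (b j • ξ)) := by
  rw [← integral_complex_ofReal]
  simp only [ofReal_gaussKernel hc]
  rw [integral_const_mul, integral_integral_swap]
  · congr 2
    funext ξ
    have hfac : ∀ z : Fin m → F, Complex.exp (-(c ^ 2 : ℝ) * ‖ξ‖ ^ 2 +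
        Complex.I * inner ℝ (y + ∑ j, b j • z j) ξ) =
        Complex.exp (inner ℝ y ξ * Complex.I) * Real.exp (-(c ^ 2 * ‖ξ‖ ^ 2)) *
          ∏ j, Complex.exp (inner ℝ (z j) (b j • ξ) * Complex.I) := by
      intro z
      rw [← Complex.exp_sum, Complex.ofReal_exp, ← Complex.exp_add, ← Complex.exp_add]
      congr 1
      rw [inner_add_left, sum_inner]
      simp only [inner_smul_left, inner_smul_right, RCLike.conj_to_real]
      push_cast
      rw [← Finset.sum_mul]
      ring
    simp only [hfac, charFun_apply]
    rw [integral_const_mul, mul_assoc, integral_fintype_prod_eq_prod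
      (fun j (z : F) => Complex.exp (inner ℝ z (b j • ξ) * Complex.I))]
  · refine ((integrable_exp_neg_sq_mul_norm_sq hc).comp_snd
      (Measure.pi (fun _ : Fin m => ν))).mono' ?_ (ae_of_all _ fun p => ?_)
    · apply Continuous.aestronglyMeasurable
      unfold Function.uncurry
      fun_prop
    · simp only [Function.uncurry, Complex.norm_exp]
      apply le_of_eq
      congr 1
      simp [← Complex.ofReal_pow]

theorem ballSmoothing_gaussKernel (r c : ℝ) {m : ℕ} (b : Fin m → ℝ) (y : F) :
    ballSmoothing r b (fun x => ENNReal.ofReal (gaussKernel c x)) y =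
      ENNReal.ofReal (∫ z : Fin m → F, gaussKernel c (y + ∑ j, b j • z j)
        ∂Measure.pi (fun _ => volume.restrict (Metric.closedBall 0 r))) := by
  have hfin : IsFiniteMeasure (volume.restrict (Metric.closedBall (0 : F) r)) :=
    ⟨by simpa using measure_closedBall_lt_top⟩
  have := continuous_gaussKernel c (F := F)
  rw [ballSmoothing, ofReal_integral_eq_lintegral_ofReal]
  · refine Integrable.of_bound (C := gaussKernel c (0 : F))
      (by apply Continuous.aestronglyMeasurable; fun_prop) (ae_of_all _ fun z => ?_)
    rw [Real.norm_of_nonneg (gaussKernel_nonneg _ _)]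
    exact gaussKernel_le _ _
  · exact ae_of_all _ fun z => gaussKernel_nonneg _ _

end Fourier

/-! ### The real case: `sinc` and the cosine. -/

section Real

theorem charFun_closedBall_real (ξ : ℝ) :
    charFun (volume.restrict (Metric.closedBall (0 : ℝ) (1 / 2))) ξ = Real.sinc (ξ / 2) := by
  rw [charFun_apply_real, Real.closedBall_eq_Icc, integral_Icc_eq_integral_Ioc,
    ← intervalIntegral.integral_of_le (by norm_num)]
  rcases eq_or_ne ξ 0 with rfl | hξ
  · norm_num
  · have hne : Complex.I * ξ ≠ 0 := mul_ne_zero Complex.I_ne_zero (by exact_mod_cast hξ)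
    have h : ∀ x : ℝ, Complex.exp (ξ * x * Complex.I) = Complex.exp (Complex.I * ξ * x) :=
      fun x => by ring_nf
    have hξ' : (ξ : ℂ) ≠ 0 := by exact_mod_cast hξ
    simp only [h]
    rw [integral_exp_mul_complex hne, Real.sinc_of_ne_zero (by simpa using hξ), Complex.ofReal_div,
      Complex.ofReal_sin, Complex.sin]
    have hI := Complex.I_ne_zero
    push_cast
    rw [show Complex.I * ξ * (0 + 1 / 2) = ξ / 2 * Complex.I by ring,
      show Complex.I * ξ * (0 - 1 / 2) = -(ξ / 2) * Complex.I by ring]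
    field_simp
    rw [Complex.I_sq]
    ring

/-- The imaginary part drops out, evenness folds the line onto the half-line, and `ξ = 2 s` undoes
the radius `1/2`. The constant is `(2π)⁻¹ · 2 · 2 = 2/π`, and the width becomes `2 c`. -/
theorem integral_pi_gaussKernel_real {c : ℝ} (hc : 0 < c) {m : ℕ}
    (a : EuclideanSpace ℝ (Fin (m + 1))) (k : Fin (m + 1)) :
    ∫ z : Fin m → ℝ, gaussKernel c (a k • (1 / 2 : ℝ) + ∑ j, a (k.succAbove j) • z j)
        ∂Measure.pi (fun _ => volume.restrict (Metric.closedBall (0 : ℝ) (1 / 2))) =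
      2 / Real.pi * ∫ s in Set.Ioi (0 : ℝ), integrandReal a k s * Real.exp (-(2 * c * s) ^ 2) := by
  have hfin : IsFiniteMeasure (volume.restrict (Metric.closedBall (0 : ℝ) (1 / 2))) :=
    ⟨by simp⟩
  have hF := integral_pi_gaussKernel hc (volume.restrict (Metric.closedBall (0 : ℝ) (1 / 2)))
    (fun j => a (k.succAbove j)) (a k • (1 / 2 : ℝ))
  have hre := congrArg Complex.re hF
  rw [Complex.ofReal_re, Complex.re_ofReal_mul] at hre
  rw [hre]
  simp only [charFun_closedBall_real]
  have hterm : ∀ ξ : ℝ, (Complex.exp (inner ℝ (a k • (1 / 2 : ℝ)) ξ * Complex.I) *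
      (Real.exp (-(c ^ 2 * ‖ξ‖ ^ 2)) *
        ∏ j, (Real.sinc ((a (k.succAbove j) • ξ) / 2) : ℂ))).re =
      integrandReal a k (ξ / 2) * Real.exp (-(c * ξ) ^ 2) := by
    intro ξ
    rw [← Complex.ofReal_prod, ← Complex.ofReal_mul, Complex.re_mul_ofReal,
      Complex.exp_ofReal_mul_I_re, integrandReal, ← Finset.compl_singleton,
      ← Fin.image_succAbove_univ, Finset.prod_image (fun i _ j _ h =>
        Fin.succAbove_right_injective h)]
    simp only [smul_eq_mul, mul_div_assoc, Real.norm_eq_abs, sq_abs, mul_pow]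
    have : inner ℝ (a k * (1 / 2)) ξ = a k * (ξ / 2) := by
      rw [RCLike.inner_apply, RCLike.conj_to_real]
      ring
    rw [this]
    ring
  have hint : Integrable (fun ξ : ℝ => Complex.exp (inner ℝ (a k • (1 / 2 : ℝ)) ξ * Complex.I) *
      (Real.exp (-(c ^ 2 * ‖ξ‖ ^ 2)) *
        ∏ j, (Real.sinc ((a (k.succAbove j) • ξ) / 2) : ℂ))) := by
    have := Real.continuous_sinc
    refine (integrable_exp_neg_sq_mul_norm_sq (F := ℝ) hc).mono'
      (by apply Continuous.aestronglyMeasurable; fun_prop) (ae_of_all _ fun ξ => ?_)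
    rw [norm_mul, norm_mul, Complex.norm_exp_ofReal_mul_I, one_mul, Complex.norm_real,
      Real.norm_of_nonneg (Real.exp_pos _).le, norm_prod]
    refine mul_le_of_le_one_right (Real.exp_pos _).le
      (Finset.prod_le_one (fun i _ => norm_nonneg _) fun i _ => ?_)
    rw [Complex.norm_real]
    exact Real.abs_sinc_le_one _
  have hre2 := integral_re hint
  simp only [RCLike.re_eq_complex_re] at hre2
  rw [← hre2]
  simp only [hterm]
  have heven : ∀ ξ : ℝ, integrandReal a k (ξ / 2) * Real.exp (-(c * ξ) ^ 2) =
      integrandReal a k (|ξ| / 2) * Real.exp (-(c * |ξ|) ^ 2) := by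
    intro ξ
    rcases abs_choice ξ with h | h <;> rw [h]
    simp [integrandReal, neg_div, Real.sinc_neg]
  have hcongr : ∫ ξ : ℝ, integrandReal a k (ξ / 2) * Real.exp (-(c * ξ) ^ 2) =
      ∫ ξ : ℝ, integrandReal a k (|ξ| / 2) * Real.exp (-(c * |ξ|) ^ 2) :=
    integral_congr_ae (ae_of_all _ heven)
  rw [hcongr, integral_comp_abs (f := fun ξ => integrandReal a k (ξ / 2) *
    Real.exp (-(c * ξ) ^ 2))]
  have hsub := integral_comp_mul_left_Ioi
    (fun ξ => integrandReal a k (ξ / 2) * Real.exp (-(c * ξ) ^ 2)) 0 (two_pos)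
  have hs2 : ∀ s : ℝ, integrandReal a k (2 * s / 2) * Real.exp (-(c * (2 * s)) ^ 2) =
      integrandReal a k s * Real.exp (-(2 * c * s) ^ 2) := by
    intro s
    rw [mul_div_cancel_left₀ _ (two_ne_zero)]
    ring_nf
  simp only [hs2, mul_zero, smul_eq_mul] at hsub
  rw [hsub]
  rw [Module.finrank_self, pow_one, ← mul_assoc, ← mul_assoc]
  congr 1
  field_simp

end Real

/-! ### The complex case: polar coordinates and the Hankel transform. -/

theorem integral_exp_mul_sin (t : ℝ) :
    ∫ θ in (-Real.pi)..Real.pi, Complex.exp (t * Real.sin θ * Complex.I) =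
      2 * Real.pi * besselJ 0 t := by
  have hint : ∀ a b : ℝ, IntervalIntegrable
      (fun θ : ℝ => Complex.exp (t * Real.sin θ * Complex.I)) volume a b :=
    fun a b => by apply Continuous.intervalIntegrable; fun_prop
  rw [← intervalIntegral.integral_add_adjacent_intervals (hint (-Real.pi) 0) (hint 0 Real.pi)]
  have hneg := intervalIntegral.integral_comp_neg (a := 0) (b := Real.pi)
    (fun θ : ℝ => Complex.exp (t * Real.sin θ * Complex.I))
  rw [neg_zero] at hneg
  have hint' : IntervalIntegrable
      (fun θ : ℝ => Complex.exp (t * Real.sin (-θ) * Complex.I)) volume 0 Real.pi := by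
    apply Continuous.intervalIntegrable; fun_prop
  rw [← hneg, ← intervalIntegral.integral_add hint' (hint 0 Real.pi), besselJ_zero_eq]
  have hcos : ∀ θ : ℝ, Complex.exp (t * Real.sin (-θ) * Complex.I) +
      Complex.exp (t * Real.sin θ * Complex.I) = ((2 * Real.cos (t * Real.sin θ) : ℝ) : ℂ) := by
    intro θ
    push_cast
    rw [Complex.two_cos]
    rw [Complex.sin_neg]
    ring_nf
  simp only [hcos]
  rw [intervalIntegral.integral_ofReal, intervalIntegral.integral_const_mul]
  have hpi : (Real.pi : ℂ) ≠ 0 := by exact_mod_cast Real.pi_ne_zero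
  push_cast
  field_simp

/-- In this form the direction of `w` is a mere shift of the angle, which an integral over a full
period does not see. -/
theorem inner_polarCoord_symm (ρ θ : ℝ) (w : ℂ) :
    inner ℝ (Complex.polarCoord.symm (ρ, θ)) w =
      ρ * ‖w‖ * Real.sin (θ + (Real.pi / 2 - w.arg)) := by
  rw [← add_sub_assoc, add_sub_right_comm, Real.sin_add_pi_div_two, Real.cos_sub, Complex.inner,
    Complex.polarCoord_symm_apply]
  have h1 := Complex.norm_mul_cos_arg w
  have h2 := Complex.norm_mul_sin_arg w
  simp only [Complex.mul_re, Complex.conj_re, Complex.conj_im, Complex.ofReal_re,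
    Complex.ofReal_im, Complex.add_re, Complex.add_im, Complex.mul_im, Complex.I_re, Complex.I_im]
  linear_combination (-ρ * Real.cos θ) * h1 - (ρ * Real.sin θ) * h2

theorem integral_exp_inner_polarCoord_symm (ρ : ℝ) (w : ℂ) :
    ∫ θ in Set.Ioo (-Real.pi) Real.pi,
      Complex.exp (inner ℝ (Complex.polarCoord.symm (ρ, θ)) w * Complex.I) =
      2 * Real.pi * besselJ 0 (ρ * ‖w‖) := by
  rw [← integral_Ioc_eq_integral_Ioo, ← intervalIntegral.integral_of_le
    (by linarith [Real.pi_pos]), ← integral_exp_mul_sin]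
  have hper : Function.Periodic
      (fun θ : ℝ => Complex.exp (((ρ * ‖w‖ : ℝ) : ℂ) * Real.sin θ * Complex.I))
      (2 * Real.pi) := by
    intro θ
    simp only [Real.sin_add_two_pi]
  have h1 := intervalIntegral.integral_comp_add_right (a := -Real.pi) (b := Real.pi)
    (fun θ : ℝ => Complex.exp (((ρ * ‖w‖ : ℝ) : ℂ) * Real.sin θ * Complex.I))
    (Real.pi / 2 - w.arg)
  have h2 := hper.intervalIntegral_add_eq (-Real.pi + (Real.pi / 2 - w.arg)) (-Real.pi)
  rw [show -Real.pi + (Real.pi / 2 - w.arg) + 2 * Real.pi = Real.pi + (Real.pi / 2 - w.arg) by ring,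
    show -Real.pi + 2 * Real.pi = Real.pi by ring] at h2
  rw [← h2, ← h1]
  simp only [inner_polarCoord_symm]
  push_cast
  rfl

/-- The Fourier transform of a radial function on `ℂ` as a Hankel transform. -/
theorem integral_exp_inner_mul_radial {R : ℝ → ℝ} (hR : Measurable R)
    (hint : IntegrableOn (fun ρ => ρ * R ρ) (Set.Ioi 0)) (w : ℂ) :
    ∫ z : ℂ, Complex.exp (inner ℝ z w * Complex.I) * R ‖z‖ =
      ((2 * Real.pi * ∫ ρ in Set.Ioi (0 : ℝ), ρ * R ρ * besselJ 0 (ρ * ‖w‖) : ℝ) : ℂ) := by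
  rw [← Complex.integral_comp_polarCoord_symm, polarCoord_target, Measure.volume_eq_prod,
    setIntegral_prod]
  · have hinner : ∀ ρ ∈ Set.Ioi (0 : ℝ), ∫ θ in Set.Ioo (-Real.pi) Real.pi,
        (ρ, θ).1 • (Complex.exp (inner ℝ (Complex.polarCoord.symm (ρ, θ)) w * Complex.I) *
          (R ‖Complex.polarCoord.symm (ρ, θ)‖ : ℂ)) =
        ((2 * Real.pi * (ρ * R ρ * besselJ 0 (ρ * ‖w‖)) : ℝ) : ℂ) := by
      intro ρ hρ
      have hρ0 : (0 : ℝ) < ρ := hρ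
      have : ∀ θ : ℝ, (ρ, θ).1 • (Complex.exp (inner ℝ (Complex.polarCoord.symm (ρ, θ)) w *
          Complex.I) * (R ‖Complex.polarCoord.symm (ρ, θ)‖ : ℂ)) =
          (ρ * R ρ : ℂ) *
            Complex.exp (inner ℝ (Complex.polarCoord.symm (ρ, θ)) w * Complex.I) := by
        intro θ
        rw [Complex.norm_polarCoord_symm, abs_of_pos hρ0, Complex.real_smul]
        ring
      simp only [this]
      rw [integral_const_mul, integral_exp_inner_polarCoord_symm]
      push_cast
      ring
    rw [setIntegral_congr_fun measurableSet_Ioi hinner, integral_complex_ofReal,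
      integral_const_mul]
  · rw [IntegrableOn, ← Measure.prod_restrict]
    have hconst : Integrable (fun _ : ℝ => (1 : ℝ))
        (volume.restrict (Set.Ioo (-Real.pi) Real.pi)) := by
      rw [integrable_const_iff]
      right
      exact ⟨by simp⟩
    refine (hint.norm.mul_prod hconst).mono' ?_ ?_
    · apply Measurable.aestronglyMeasurable
      simp only [Complex.polarCoord_symm_apply]
      fun_prop
    · rw [Measure.prod_restrict]
      refine (ae_restrict_iff' (measurableSet_Ioi.prod measurableSet_Ioo)).2
        (ae_of_all _ fun p hp => ?_)
      have hp0 : 0 < p.1 := hp.1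
      simp only [Complex.norm_polarCoord_symm, norm_smul, norm_mul, Complex.norm_exp_ofReal_mul_I,
        one_mul, mul_one, Complex.norm_real]
      rw [abs_of_pos hp0]

/-- A consequence of `(x J₁(x))' = x J₀(x)`; it turns the Hankel transform of the indicator of a
disc into `jOne`. -/
theorem integral_mul_besselJ_zero (r t : ℝ) :
    ∫ ρ in (0 : ℝ)..r, ρ * besselJ 0 (ρ * t) = r ^ 2 / 2 * jOne (r * t) := by
  have hc := continuous_besselJ_zero
  rcases eq_or_ne t 0 with rfl | ht
  · simp [besselJ_zero_zero, jOne]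
  · have hd : ∀ ρ ∈ Set.uIcc 0 r, HasDerivAt (fun ρ => (ρ * t) * besselJ 1 (ρ * t) / t ^ 2)
        (ρ * besselJ 0 (ρ * t)) ρ := by
      intro ρ _
      have := ((hasDerivAt_mul_besselJ_one (ρ * t)).comp ρ
        ((hasDerivAt_id ρ).mul_const t)).div_const (t ^ 2)
      convert! this using 1
      field_simp
    rw [intervalIntegral.integral_eq_sub_of_hasDerivAt hd
      (by apply Continuous.intervalIntegrable; fun_prop)]
    have := jOne_mul_self (r * t)
    simp only [zero_mul, zero_div, sub_zero]
    rw [div_eq_iff (by positivity)]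
    linear_combination (-(r * t) / 2) * this

theorem charFun_closedBall_complex {r : ℝ} (hr : 0 < r) (hr2 : Real.pi * r ^ 2 = 1) (ξ : ℂ) :
    charFun (volume.restrict (Metric.closedBall (0 : ℂ) r)) ξ = jOne (r * ‖ξ‖) := by
  have hmeas : Measurable (Set.indicator (Set.Iic r) (fun _ => (1 : ℝ))) :=
    measurable_const.indicator measurableSet_Iic
  have hind : ∀ ρ g : ℝ, ρ * Set.indicator (Set.Iic r) (fun _ => (1 : ℝ)) ρ * g =
      Set.indicator (Set.Iic r) (fun _ => ρ * g) ρ := by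
    intro ρ g
    by_cases h : ρ ∈ Set.Iic r <;> simp [h]
  have hint : IntegrableOn (fun ρ => ρ * Set.indicator (Set.Iic r) (fun _ => (1 : ℝ)) ρ)
      (Set.Ioi 0) := by
    have h : (fun ρ => ρ * Set.indicator (Set.Iic r) (fun _ => (1 : ℝ)) ρ) =
        Set.indicator (Set.Iic r) (fun ρ => ρ) := by
      funext ρ
      by_cases h : ρ ∈ Set.Iic r <;> simp [h]
    rw [h, IntegrableOn, integrable_indicator_iff measurableSet_Iic, IntegrableOn,
      Measure.restrict_restrict measurableSet_Iic, Set.inter_comm, Set.Ioi_inter_Iic]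
    exact (continuous_id.intervalIntegrable 0 r).1
  have key := integral_exp_inner_mul_radial hmeas hint ξ
  have hval : ∫ ρ in Set.Ioi (0 : ℝ), ρ * Set.indicator (Set.Iic r) (fun _ => (1 : ℝ)) ρ *
      besselJ 0 (ρ * ‖ξ‖) = r ^ 2 / 2 * jOne (r * ‖ξ‖) := by
    rw [← integral_mul_besselJ_zero, intervalIntegral.integral_of_le hr.le, ← Set.Ioi_inter_Iic,
      Set.inter_comm, ← Measure.restrict_restrict measurableSet_Iic,
      ← integral_indicator measurableSet_Iic]
    refine integral_congr_ae (ae_of_all _ fun ρ => ?_)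
    simp only [hind]
    by_cases h : ρ ∈ Set.Iic r <;> simp [h]
  rw [hval, show 2 * Real.pi * (r ^ 2 / 2 * jOne (r * ‖ξ‖)) = jOne (r * ‖ξ‖) by
    linear_combination jOne (r * ‖ξ‖) * hr2] at key
  rw [charFun_apply, ← key, ← integral_indicator Metric.isClosed_closedBall.measurableSet]
  refine integral_congr_ae (ae_of_all _ fun z => ?_)
  by_cases h : ‖z‖ ≤ r <;> simp [Set.indicator, h]

/-- The transformed integrand is radial apart from the shift phase, so its planar integral is a
Hankel transform. With `ρ = s / r` the constant is `(2π)⁻² · 2π · r⁻²`, which equals `1/2` because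
`π r² = 1`. -/
theorem integral_pi_gaussKernel_complex {r c : ℝ} (hr : 0 < r) (hr2 : Real.pi * r ^ 2 = 1)
    (hc : 0 < c) {m : ℕ} (a : EuclideanSpace ℝ (Fin (m + 1))) (k : Fin (m + 1)) :
    ∫ z : Fin m → ℂ, gaussKernel c (a k • (r : ℂ) + ∑ j, a (k.succAbove j) • z j)
        ∂Measure.pi (fun _ => volume.restrict (Metric.closedBall (0 : ℂ) r)) =
      1 / 2 * ∫ s in Set.Ioi (0 : ℝ), integrandComplex a k s * Real.exp (-(r⁻¹ * c * s) ^ 2) := by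
  have hfin : IsFiniteMeasure (volume.restrict (Metric.closedBall (0 : ℂ) r)) :=
    ⟨by rw [Measure.restrict_apply_univ]; exact measure_closedBall_lt_top⟩
  have hF := integral_pi_gaussKernel hc (volume.restrict (Metric.closedBall (0 : ℂ) r))
    (fun j => a (k.succAbove j)) (a k • (r : ℂ))
  simp only [charFun_closedBall_complex hr hr2] at hF
  have hj := continuous_jOne
  have hJ := continuous_besselJ_zero
  let R : ℝ → ℝ := fun ρ => Real.exp (-(c ^ 2 * ρ ^ 2)) *
    ∏ j, jOne (r * (|a (k.succAbove j)| * ρ))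
  have hRc : Continuous R := by
    simp only [R]
    fun_prop
  have hint : IntegrableOn (fun ρ => ρ * R ρ) (Set.Ioi 0) := by
    refine Integrable.integrableOn ?_
    refine (integrable_mul_exp_neg_mul_sq (b := c ^ 2) (by positivity)).norm.mono'
      (by apply Continuous.aestronglyMeasurable; fun_prop) (ae_of_all _ fun ρ => ?_)
    simp only [R]
    rw [← mul_assoc, norm_mul, neg_mul]
    refine mul_le_of_le_one_right (norm_nonneg _) ?_
    rw [norm_prod]
    exact Finset.prod_le_one (fun i _ => norm_nonneg _) fun i _ => abs_jOne_le_one _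
  have key := integral_exp_inner_mul_radial hRc.measurable hint (a k • (r : ℂ))
  have hcongr : ∫ ξ : ℂ, Complex.exp (inner ℝ (a k • (r : ℂ)) ξ * Complex.I) *
      (Real.exp (-(c ^ 2 * ‖ξ‖ ^ 2)) * ∏ j, (jOne (r * ‖a (k.succAbove j) • ξ‖) : ℂ)) =
      ∫ ξ : ℂ, Complex.exp (inner ℝ ξ (a k • (r : ℂ)) * Complex.I) * R ‖ξ‖ := by
    refine integral_congr_ae (ae_of_all _ fun ξ => ?_)
    simp only [R, norm_smul, Real.norm_eq_abs]
    rw [real_inner_comm]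
    push_cast
    rfl
  rw [hcongr, key, ← Complex.ofReal_mul, Complex.ofReal_inj] at hF
  rw [hF]
  have hsub := integral_comp_mul_left_Ioi
    (fun ρ => ρ * R ρ * besselJ 0 (ρ * ‖a k • (r : ℂ)‖)) 0 (inv_pos.2 hr)
  have habs : ∀ b s : ℝ, jOne (|b| * s) = jOne (b * s) := by
    intro b s
    rcases abs_choice b with h | h <;> rw [h]
    rw [neg_mul, jOne_neg]
  have hterm : ∀ s : ℝ, r⁻¹ * s * R (r⁻¹ * s) * besselJ 0 (r⁻¹ * s * ‖a k • (r : ℂ)‖) =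
      r⁻¹ * (integrandComplex a k s * Real.exp (-(r⁻¹ * c * s) ^ 2)) := by
    intro s
    have h1 : besselJ 0 (r⁻¹ * s * ‖a k • (r : ℂ)‖) = besselJ 0 (a k * s) := by
      rw [norm_smul, Complex.norm_real, Real.norm_of_nonneg hr.le, Real.norm_eq_abs,
        show r⁻¹ * s * (|a k| * r) = |a k| * s by field_simp]
      rcases abs_choice (a k) with h | h <;> rw [h]
      rw [neg_mul, besselJ_zero_neg]
    have h2 : ∀ j, jOne (r * (|a (k.succAbove j)| * (r⁻¹ * s))) = jOne (a (k.succAbove j) * s) := by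
      intro j
      rw [show r * (|a (k.succAbove j)| * (r⁻¹ * s)) = |a (k.succAbove j)| * s by field_simp, habs]
    simp only [R, h1, h2]
    rw [integrandComplex, ← Finset.compl_singleton, ← Fin.image_succAbove_univ,
      Finset.prod_image (fun i _ j _ h => Fin.succAbove_right_injective h),
      show c ^ 2 * (r⁻¹ * s) ^ 2 = (r⁻¹ * c * s) ^ 2 by ring]
    ring
  simp only [hterm, mul_zero, smul_eq_mul, inv_inv] at hsub
  rw [integral_const_mul, inv_mul_eq_iff_eq_mul₀ hr.ne'] at hsub
  rw [Complex.finrank_real_complex]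
  have hpi := Real.pi_pos
  have hrr : ∀ A B : ℝ, A = r * (r * B) → ((2 * Real.pi) ^ 2)⁻¹ * (2 * Real.pi * B) = 1 / 2 * A := by
    rintro A B rfl
    field_simp
    linear_combination (-B) * hr2
  exact hrr _ _ hsub

/-! ### Orthogonal splitting along `a` and the volume of the section. -/

section Section

variable {F : Type*} [NormedAddCommGroup F] [InnerProductSpace ℝ F]

/-- The isometric embedding `u ↦ (a_j u)_j` of `F` into `Fⁿ`, for a unit vector `a`. -/
noncomputable def diagEmbedding {n : ℕ} (a : Fin n → ℝ) (ha : ∑ j, a j ^ 2 = 1) :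
    F →ₗᵢ[ℝ] PiLp 2 (fun _ : Fin n => F) where
  toFun u := WithLp.toLp 2 (fun j => a j • u)
  map_add' u v := by ext j; simp
  map_smul' t u := by ext j; simp [smul_comm t]
  norm_map' u := by
    rw [← sq_eq_sq₀ (norm_nonneg _) (norm_nonneg _), PiLp.norm_sq_eq_of_L2]
    change ∑ j, ‖a j • u‖ ^ 2 = ‖u‖ ^ 2
    simp only [norm_smul, mul_pow, Real.norm_eq_abs, sq_abs]
    rw [← Finset.sum_mul, ha, one_mul]

theorem diagEmbedding_apply {n : ℕ} (a : Fin n → ℝ) (ha : ∑ j, a j ^ 2 = 1) (u : F) (j : Fin n) :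
    diagEmbedding a ha u j = a j • u := rfl

theorem inner_diagEmbedding {n : ℕ} (a : Fin n → ℝ) (ha : ∑ j, a j ^ 2 = 1) (u : F)
    (x : PiLp 2 (fun _ : Fin n => F)) :
    inner ℝ (diagEmbedding a ha u) x = inner ℝ u (∑ j, a j • x j) := by
  rw [PiLp.inner_apply, inner_sum]
  simp only [diagEmbedding_apply, inner_smul_left, inner_smul_right, RCLike.conj_to_real]

/-- The hyperplane `∑ a_j x_j = 0` in `Fⁿ`. -/
noncomputable def sectionSpace {n : ℕ} (a : Fin n → ℝ) (ha : ∑ j, a j ^ 2 = 1) :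
    Submodule ℝ (PiLp 2 (fun _ : Fin n => F)) :=
  (LinearMap.range (diagEmbedding (F := F) a ha).toLinearMap)ᗮ

theorem mem_sectionSpace {n : ℕ} {a : Fin n → ℝ} {ha : ∑ j, a j ^ 2 = 1}
    {x : PiLp 2 (fun _ : Fin n => F)} : x ∈ sectionSpace a ha ↔ ∑ j, a j • x j = 0 := by
  rw [sectionSpace, Submodule.mem_orthogonal]
  constructor
  · intro h
    have := h _ ⟨∑ j, a j • x j, rfl⟩
    change inner ℝ (diagEmbedding a ha _) x = 0 at this
    rwa [inner_diagEmbedding, inner_self_eq_zero] at this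
  · rintro h _ ⟨u, rfl⟩
    change inner ℝ (diagEmbedding a ha u) x = 0
    rw [inner_diagEmbedding, h, inner_zero_right]

theorem inner_diagEmbedding_sectionSpace {n : ℕ} {a : Fin n → ℝ} {ha : ∑ j, a j ^ 2 = 1} (u : F)
    (y : sectionSpace (F := F) a ha) :
    inner ℝ (diagEmbedding a ha u) (y : PiLp 2 (fun _ : Fin n => F)) = 0 := by
  rw [inner_diagEmbedding, mem_sectionSpace.1 y.2, inner_zero_right]

theorem norm_diagEmbedding_add_sq {n : ℕ} {a : Fin n → ℝ} {ha : ∑ j, a j ^ 2 = 1} (u : F)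
    (y : sectionSpace (F := F) a ha) :
    ‖diagEmbedding a ha u + y‖ ^ 2 = ‖u‖ ^ 2 + ‖y‖ ^ 2 := by
  rw [norm_add_sq_real, inner_diagEmbedding_sectionSpace, LinearIsometry.norm_map]
  simp

/-- The orthogonal splitting of `Fⁿ` along a unit vector `a`, as an isometry. -/
noncomputable def splittingIsometry {n : ℕ} (a : Fin n → ℝ) (ha : ∑ j, a j ^ 2 = 1) :
    WithLp 2 (F × sectionSpace (F := F) a ha) →ₗᵢ[ℝ] PiLp 2 (fun _ : Fin n => F) where
  toFun p := diagEmbedding a ha p.fst + p.snd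
  map_add' p q := by simp only [WithLp.add_fst, WithLp.add_snd, map_add, Submodule.coe_add]; abel
  map_smul' t p := by simp
  norm_map' p := by
    rw [← sq_eq_sq₀ (norm_nonneg _) (norm_nonneg _), WithLp.prod_norm_sq_eq_of_L2]
    exact norm_diagEmbedding_add_sq _ _

variable [FiniteDimensional ℝ F]

theorem finrank_sectionSpace {m : ℕ} (a : Fin (m + 1) → ℝ) (ha : ∑ j, a j ^ 2 = 1) :
    Module.finrank ℝ (sectionSpace (F := F) a ha) = Module.finrank ℝ F * m := by
  have h := Submodule.finrank_add_finrank_orthogonal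
    (LinearMap.range (diagEmbedding (F := F) a ha).toLinearMap)
  have h1 : Module.finrank ℝ (PiLp 2 (fun _ : Fin (m + 1) => F)) =
      Module.finrank ℝ F * (m + 1) := by
    rw [(WithLp.linearEquiv 2 ℝ (Fin (m + 1) → F)).finrank_eq, Module.finrank_pi_fintype]
    simp [mul_comm]
  rw [LinearMap.finrank_range_of_inj (diagEmbedding (F := F) a ha).injective, h1, mul_add_one] at h
  change Module.finrank ℝ F + Module.finrank ℝ (sectionSpace (F := F) a ha) = _ at h
  omega

variable [MeasurableSpace F] [BorelSpace F]

/-- The product volume and the Euclidean volume are both Haar measures, hence proportional;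
integrating `exp (-‖x‖²)` against each shows that the factor is one. -/
theorem measurePreserving_toLp_pi (n : ℕ) :
    MeasurePreserving (WithLp.toLp 2 : (Fin n → F) → PiLp 2 (fun _ : Fin n => F))
      volume volume := by
  have hmeas : Measurable (WithLp.toLp 2 : (Fin n → F) → PiLp 2 (fun _ : Fin n => F)) :=
    (PiLp.continuous_toLp 2 _).measurable
  refine ⟨hmeas, ?_⟩
  set μ := Measure.map (WithLp.toLp 2 : (Fin n → F) → PiLp 2 (fun _ : Fin n => F)) volume with hμ
  have hhaar : μ.IsAddHaarMeasure :=
    (PiLp.continuousLinearEquiv 2 ℝ (fun _ : Fin n => F)).symm.isAddHaarMeasure_map volume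
  have hsmul := Measure.isAddLeftInvariant_eq_smul μ (volume : Measure (PiLp 2 fun _ : Fin n => F))
  have hpi := Real.pi_pos
  have h1 : ∫ x, Real.exp (-1 * ‖x‖ ^ 2) ∂μ = (Real.pi / 1) ^ (n * Module.finrank ℝ F / 2 : ℝ) := by
    rw [hμ, integral_map hmeas.aemeasurable
      (by apply Continuous.aestronglyMeasurable; fun_prop)]
    have : ∀ x : Fin n → F, Real.exp (-1 * ‖(WithLp.toLp 2 x : PiLp 2 (fun _ : Fin n => F))‖ ^ 2) =
        ∏ j, Real.exp (-1 * ‖x j‖ ^ 2) := by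
      intro x
      rw [PiLp.norm_sq_eq_of_L2, Finset.mul_sum, Real.exp_sum]
    simp only [this]
    rw [integral_fintype_prod_volume_eq_pow (fun x : F => Real.exp (-1 * ‖x‖ ^ 2)),
      GaussianFourier.integral_rexp_neg_mul_sq_norm one_pos, Fintype.card_fin,
      ← Real.rpow_natCast, ← Real.rpow_mul (by positivity)]
    congr 1
    ring
  have h2 : ∫ x : PiLp 2 (fun _ : Fin n => F), Real.exp (-1 * ‖x‖ ^ 2) =
      (Real.pi / 1) ^ (n * Module.finrank ℝ F / 2 : ℝ) := by
    rw [GaussianFourier.integral_rexp_neg_mul_sq_norm one_pos,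
      (WithLp.linearEquiv 2 ℝ (Fin n → F)).finrank_eq, Module.finrank_pi_fintype]
    simp
  rw [hsmul, integral_smul_nnreal_measure, h2] at h1
  have hpos : (Real.pi / 1) ^ (n * Module.finrank ℝ F / 2 : ℝ) ≠ 0 := by positivity
  have hone : μ.addHaarScalarFactor volume = 1 := by
    rw [NNReal.smul_def, smul_eq_mul] at h1
    have := mul_right_cancel₀ hpos (h1.trans (one_mul _).symm)
    exact_mod_cast this
  rw [hsmul, hone, one_smul]

theorem measurePreserving_splitting {m : ℕ} (a : Fin (m + 1) → ℝ) (ha : ∑ j, a j ^ 2 = 1) :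
    MeasurePreserving (fun p : F × sectionSpace (F := F) a ha =>
      diagEmbedding a ha p.1 + (p.2 : PiLp 2 (fun _ : Fin (m + 1) => F))) volume volume := by
  have hrank : Module.finrank ℝ (WithLp 2 (F × sectionSpace (F := F) a ha)) =
      Module.finrank ℝ (PiLp 2 (fun _ : Fin (m + 1) => F)) := by
    rw [(WithLp.linearEquiv 2 ℝ (F × sectionSpace (F := F) a ha)).finrank_eq, Module.finrank_prod,
      finrank_sectionSpace, (WithLp.linearEquiv 2 ℝ (Fin (m + 1) → F)).finrank_eq,
      Module.finrank_pi_fintype]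
    simp
    ring
  have h1 := ((splittingIsometry (F := F) a ha).toLinearIsometryEquiv hrank).measurePreserving
  exact h1.comp (WithLp.volume_preserving_toLp F (sectionSpace (F := F) a ha))

/-- The set of points of `Fⁿ` whose coordinates all have norm at most `r`. -/
def ballProduct (F : Type*) [NormedAddCommGroup F] (n : ℕ) (r : ℝ) :
    Set (PiLp 2 (fun _ : Fin n => F)) := {x | ∀ i, ‖x i‖ ≤ r}

omit [InnerProductSpace ℝ F] [FiniteDimensional ℝ F] [MeasurableSpace F] [BorelSpace F] in
theorem isClosed_ballProduct (n : ℕ) (r : ℝ) : IsClosed (ballProduct F n r) := by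
  simp only [ballProduct, Set.ofPred_forall]
  exact isClosed_iInter fun i => isClosed_le (by fun_prop) continuous_const

/-- In the orthogonal coordinates `x = (a_j u)_j + y`, with `y` in the hyperplane, `∑ a_j x_j` is
exactly `u` because `∑ a_j² = 1`. So `g` depends on `u` alone, and no Jacobian factor appears. -/
theorem ballSmoothing_zero_eq {m : ℕ} (a : Fin (m + 1) → ℝ) (ha : ∑ j, a j ^ 2 = 1)
    {g : F → ENNReal} (hg : Measurable g) (r : ℝ) :
    ballSmoothing r a g 0 = ∫⁻ p : F × sectionSpace (F := F) a ha,
      g p.1 * (ballProduct F (m + 1) r).indicator 1 (diagEmbedding a ha p.1 + p.2) := by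
  have hQ := (isClosed_ballProduct (F := F) (m + 1) r).measurableSet
  let f : PiLp 2 (fun _ : Fin (m + 1) => F) → ENNReal :=
    fun x => g (∑ j, a j • x j) * (ballProduct F (m + 1) r).indicator 1 x
  have hf : Measurable f := by
    refine Measurable.mul (hg.comp ?_) (measurable_one.indicator hQ)
    exact Continuous.measurable (by fun_prop)
  have h1 := (measurePreserving_toLp_pi (F := F) (m + 1)).lintegral_comp hf
  have h2 := (measurePreserving_splitting (F := F) a ha).lintegral_comp hf
  have hset : Set.univ.pi (fun _ : Fin (m + 1) => Metric.closedBall (0 : F) r) =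
      WithLp.toLp 2 ⁻¹' ballProduct F (m + 1) r := by
    ext x
    simp [ballProduct]
  rw [ballSmoothing, ← Measure.restrict_pi_pi, hset, ← lintegral_indicator
    ((PiLp.continuous_toLp 2 _).measurable hQ)]
  refine Eq.trans (Eq.trans (lintegral_congr fun x => ?_) (h1.trans h2.symm))
    (lintegral_congr fun p => ?_)
  · simp only [f, zero_add]
    by_cases h : WithLp.toLp 2 x ∈ ballProduct F (m + 1) r
    · rw [Set.indicator_of_mem (by exact h), Set.indicator_of_mem h, Pi.one_apply, mul_one]
    · rw [Set.indicator_of_notMem (by exact h), Set.indicator_of_notMem h, mul_zero]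
  · simp only [f]
    congr 2
    simp only [PiLp.add_apply, smul_add, Finset.sum_add_distrib, mem_sectionSpace.1 p.2.2,
      diagEmbedding_apply, smul_smul, ← sq, ← Finset.sum_smul, ha, one_smul, add_zero]

omit [MeasurableSpace F] [BorelSpace F] [FiniteDimensional ℝ F] in
theorem gaussKernel_smul {c : ℝ} (hc : 0 < c) (v : F) :
    gaussKernel c (c • v) = (c ^ Module.finrank ℝ F)⁻¹ * gaussKernel 1 v := by
  have hpi := Real.pi_pos
  simp only [gaussKernel]
  rw [norm_smul, Real.norm_of_nonneg hc.le, Real.div_rpow hpi.le (by positivity),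
    ← Real.rpow_natCast_mul hc.le]
  have h1 : ((2 : ℕ) : ℝ) * (Module.finrank ℝ F / 2 : ℝ) = (Module.finrank ℝ F : ℝ) := by
    push_cast; ring
  have h2 : -(c * ‖v‖) ^ 2 / (4 * c ^ 2) = -‖v‖ ^ 2 / (4 * 1 ^ 2) := by
    field_simp
  rw [h1, h2, Real.rpow_natCast, one_pow, div_one]
  ring

theorem lintegral_gaussKernel_mul {c : ℝ} (hc : 0 < c) {φ : F → ENNReal} (hφ : Measurable φ) :
    ∫⁻ u : F, ENNReal.ofReal (gaussKernel c u) * φ u =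
      ∫⁻ v : F, ENNReal.ofReal (gaussKernel 1 v) * φ (c • v) := by
  have hG := (continuous_gaussKernel (F := F) c).measurable
  have hmap := lintegral_map (μ := (volume : Measure F)) (g := (c • · : F → F))
    (f := fun u => ENNReal.ofReal (gaussKernel c u) * φ u) (by fun_prop) (by fun_prop)
  have hcd : 0 < c ^ Module.finrank ℝ F := by positivity
  rw [Measure.map_addHaar_smul _ hc.ne', lintegral_smul_measure, abs_of_pos (by positivity)] at hmap
  simp only [gaussKernel_smul hc, ENNReal.ofReal_mul (inv_pos.2 hcd).le, mul_assoc] at hmap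
  rw [lintegral_const_mul' _ _ ENNReal.ofReal_ne_top, smul_eq_mul] at hmap
  exact (ENNReal.mul_right_inj (by simpa using hcd) ENNReal.ofReal_ne_top).1 hmap

theorem lintegral_gaussKernel_one : ∫⁻ v : F, ENNReal.ofReal (gaussKernel 1 v) = 1 := by
  have hpi := Real.pi_pos
  have hexp : ∀ v : F, Real.exp (-‖v‖ ^ 2 / (4 * 1 ^ 2)) = Real.exp (-(1 / 4) * ‖v‖ ^ 2) := by
    intro v
    congr 1
    ring
  have hval := GaussianFourier.integral_rexp_neg_mul_sq_norm (V := F)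
    (b := 1 / 4) (by norm_num)
  have hint : Integrable (fun v : F => Real.exp (-(1 / 4) * ‖v‖ ^ 2)) := by
    refine (integrable_exp_neg_sq_mul_norm_sq (F := F) (c := 1 / 2) (by norm_num)).congr
      (ae_of_all _ fun v => ?_)
    simp only
    congr 1
    ring
  rw [← ofReal_integral_eq_lintegral_ofReal _ (ae_of_all _ fun v => gaussKernel_nonneg _ _)]
  · simp only [gaussKernel, hexp]
    rw [integral_const_mul, hval, mul_assoc, ← Real.mul_rpow (by positivity) (by positivity),
      show Real.pi / 1 ^ 2 * (Real.pi / (1 / 4)) = (2 * Real.pi) ^ (2 : ℕ) by ring,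
      ← Real.rpow_natCast_mul (by positivity)]
    have h1 : ((2 : ℕ) : ℝ) * (Module.finrank ℝ F / 2 : ℝ) = (Module.finrank ℝ F : ℝ) := by
      push_cast; ring
    rw [h1, Real.rpow_natCast, inv_mul_cancel₀ (by positivity), ENNReal.ofReal_one]
  · simp only [gaussKernel, hexp]
    exact hint.const_mul _

/-- Rescaling `u = c v` moves the width out of the kernel into the position of the slice, which
converges to the central one as `c → 0`. -/
theorem ballSmoothing_gaussKernel_zero_eq {m : ℕ} (a : Fin (m + 1) → ℝ) (ha : ∑ j, a j ^ 2 = 1)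
    {c : ℝ} (hc : 0 < c) (r : ℝ) :
    ballSmoothing r a (fun x : F => ENNReal.ofReal (gaussKernel c x)) 0 =
      ∫⁻ p : F × sectionSpace (F := F) a ha, ENNReal.ofReal (gaussKernel 1 p.1) *
        (ballProduct F (m + 1) r).indicator 1 (diagEmbedding a ha (c • p.1) + p.2) := by
  have hG : ∀ c, Measurable (gaussKernel (F := F) c) :=
    fun c => (continuous_gaussKernel (F := F) c).measurable
  have hQ := (isClosed_ballProduct (F := F) (m + 1) r).measurableSet
  have hι : Continuous (diagEmbedding (F := F) a ha) := (diagEmbedding a ha).continuous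
  have hind : Measurable (fun p : F × sectionSpace (F := F) a ha =>
      (ballProduct F (m + 1) r).indicator (1 : PiLp 2 (fun _ : Fin (m + 1) => F) → ENNReal) (diagEmbedding a ha p.1 + p.2)) :=
    (measurable_one.indicator hQ).comp (Continuous.measurable (by fun_prop))
  have hind' : Measurable (fun p : F × sectionSpace (F := F) a ha =>
      (ballProduct F (m + 1) r).indicator (1 : PiLp 2 (fun _ : Fin (m + 1) => F) → ENNReal)
        (diagEmbedding a ha (c • p.1) + p.2)) :=
    (measurable_one.indicator hQ).comp (Continuous.measurable (by fun_prop))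
  rw [ballSmoothing_zero_eq a ha (by fun_prop), Measure.volume_eq_prod,
    lintegral_prod _ (Measurable.aemeasurable (by fun_prop)),
    lintegral_prod _ (Measurable.aemeasurable (by fun_prop))]
  simp only [lintegral_const_mul' _ _ ENNReal.ofReal_ne_top]
  exact lintegral_gaussKernel_mul hc hind.lintegral_prod_right'

omit [InnerProductSpace ℝ F] [FiniteDimensional ℝ F] [MeasurableSpace F] [BorelSpace F] in
theorem norm_le_of_mem_ballProduct {n : ℕ} {r : ℝ} {x : PiLp 2 (fun _ : Fin n => F)}
    (hx : x ∈ ballProduct F n r) : ‖x‖ ^ 2 ≤ n * r ^ 2 := by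
  rw [PiLp.norm_sq_eq_of_L2]
  calc _ ≤ ∑ _j : Fin n, r ^ 2 :=
        Finset.sum_le_sum fun i _ => pow_le_pow_left₀ (norm_nonneg _) (hx i) 2
    _ = _ := by simp

/-- The reverse Fatou lemma. If `y` lies outside the closed set `ballProduct`, then so do all nearby
points, so the indicators vanish eventually; on the section itself the bound by `1` is enough. -/
theorem limsup_ballSmoothing_gaussKernel_le {m : ℕ} (a : Fin (m + 1) → ℝ)
    (ha : ∑ j, a j ^ 2 = 1) {c : ℕ → ℝ} (hc : ∀ n, 0 < c n) (hc0 : Tendsto c atTop (𝓝 0))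
    (r : ℝ) :
    limsup (fun n => ballSmoothing r a (fun x : F => ENNReal.ofReal (gaussKernel (c n) x)) 0)
      atTop ≤ volume {y : sectionSpace (F := F) a ha |
        (y : PiLp 2 (fun _ : Fin (m + 1) => F)) ∈ ballProduct F (m + 1) r} := by
  have hG : Measurable (gaussKernel (F := F) 1) := (continuous_gaussKernel (F := F) 1).measurable
  have hQc := isClosed_ballProduct (F := F) (m + 1) r
  have hQ := hQc.measurableSet
  have hι : Continuous (diagEmbedding (F := F) a ha) := (diagEmbedding a ha).continuous
  let S : Set (sectionSpace (F := F) a ha) := {y | (y : PiLp 2 (fun _ : Fin (m + 1) => F)) ∈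
    ballProduct F (m + 1) r}
  have hS : MeasurableSet S := measurable_subtype_coe hQ
  -- A bounded set containing the hyperplane component of every point of the product, whatever `c`
  -- is; it provides the integrable majorant.
  let B : Set (sectionSpace (F := F) a ha) := Metric.closedBall 0 (Real.sqrt ((m + 1 : ℕ) * r ^ 2))
  have hB : MeasurableSet B := Metric.isClosed_closedBall.measurableSet
  have hprod : ∀ T : Set (sectionSpace (F := F) a ha), MeasurableSet T →
      ∫⁻ p : F × sectionSpace (F := F) a ha, ENNReal.ofReal (gaussKernel 1 p.1) *
        T.indicator 1 p.2 = volume T := by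
    intro T hT
    rw [Measure.volume_eq_prod, lintegral_prod_mul (f := fun v : F =>
      ENNReal.ofReal (gaussKernel 1 v)) (g := T.indicator 1) (by fun_prop)
      (measurable_one.indicator hT).aemeasurable, lintegral_gaussKernel_one, one_mul,
      lintegral_indicator_one hT]
  simp only [fun n => ballSmoothing_gaussKernel_zero_eq (F := F) a ha (hc n) r]
  refine (limsup_lintegral_le (fun p => ENNReal.ofReal (gaussKernel 1 p.1) * B.indicator 1 p.2)
    (fun n => ?_) (fun n => ae_of_all _ fun p => ?_) ?_).trans ?_
  · refine Measurable.mul (by fun_prop) ?_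
    exact (measurable_one.indicator hQ).comp (Continuous.measurable (by fun_prop))
  · refine mul_le_mul_right ?_ _
    by_cases hp : diagEmbedding a ha (c n • p.1) + (p.2 : PiLp 2 (fun _ : Fin (m + 1) => F)) ∈
        ballProduct F (m + 1) r
    · have hmem : p.2 ∈ B := by
        rw [mem_closedBall_zero_iff]
        refine Real.le_sqrt_of_sq_le (le_trans ?_ (norm_le_of_mem_ballProduct hp))
        rw [norm_diagEmbedding_add_sq]
        exact le_add_of_nonneg_left (sq_nonneg _)
      rw [Set.indicator_of_mem hp, Set.indicator_of_mem hmem, Pi.one_apply, Pi.one_apply]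
    · rw [Set.indicator_of_notMem hp]
      exact zero_le
  · rw [hprod B hB]
    exact measure_closedBall_lt_top.ne
  · rw [← hprod S hS]
    refine lintegral_mono fun p => ?_
    by_cases hp : p.2 ∈ S
    · rw [Set.indicator_of_mem hp]
      refine limsup_le_of_le (by isBoundedDefault) (Eventually.of_forall fun n => ?_)
      gcongr
      exact Set.indicator_le_self _ _ _
    · rw [Set.indicator_of_notMem hp, mul_zero]
      have hlim : Tendsto (fun n => diagEmbedding a ha (c n • p.1) +
          (p.2 : PiLp 2 (fun _ : Fin (m + 1) => F))) atTop (𝓝 p.2) := by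
        have h1 : Tendsto (fun n => diagEmbedding a ha (c n • p.1) +
          (p.2 : PiLp 2 (fun _ : Fin (m + 1) => F))) atTop
          (𝓝 (diagEmbedding a ha ((0 : ℝ) • p.1) + p.2)) :=
          ((hι.tendsto _).comp (hc0.smul_const p.1)).add_const _
        simpa using h1
      have hev : ∀ᶠ n in atTop, diagEmbedding a ha (c n • p.1) +
          (p.2 : PiLp 2 (fun _ : Fin (m + 1) => F)) ∈ (ballProduct F (m + 1) r)ᶜ :=
        hlim.eventually (hQc.isOpen_compl.mem_nhds hp)
      refine limsup_le_of_le (by isBoundedDefault) (hev.mono fun n hn => ?_)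
      rw [Set.indicator_of_notMem hn, mul_zero]

/-- Gaussian approximations to the density at `0` of `∑ a_j X_j` are asymptotically bounded by the
volume of the central section orthogonal to `a`. -/
theorem le_toReal_euclideanHausdorffMeasure {m : ℕ} (a : Fin (m + 1) → ℝ)
    (ha : ∑ j, a j ^ 2 = 1) {c : ℕ → ℝ} (hc : ∀ n, 0 < c n) (hc0 : Tendsto c atTop (𝓝 0))
    (r : ℝ) {D : ℕ → ℝ} {L : ℝ} (hD : ∀ n, ENNReal.ofReal (D n) ≤
      ballSmoothing r a (fun x : F => ENNReal.ofReal (gaussKernel (c n) x)) 0)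
    (hL : Tendsto D atTop (𝓝 L)) :
    L ≤ (μHE[Module.finrank ℝ F * m] (ballProduct F (m + 1) r ∩
      {x | ∑ j, a j • x j = 0})).toReal := by
  have himage : ballProduct F (m + 1) r ∩ {x | ∑ j, a j • x j = 0} =
      Subtype.val '' {y : sectionSpace (F := F) a ha |
        (y : PiLp 2 (fun _ : Fin (m + 1) => F)) ∈ ballProduct F (m + 1) r} := by
    ext x
    simp only [Set.mem_inter_iff, Set.mem_ofPred_eq, Set.mem_image, Subtype.exists,
      exists_and_left, exists_prop, exists_eq_right_right, mem_sectionSpace]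
  rw [himage, isometry_subtype_coe.euclideanHausdorffMeasure_image, ← finrank_sectionSpace a ha,
    InnerProductSpace.euclideanHausdorffMeasure_eq_volume]
  -- Finiteness is essential here, as `toReal` sends `⊤` to `0`.
  have hfin : volume {y : sectionSpace (F := F) a ha |
      (y : PiLp 2 (fun _ : Fin (m + 1) => F)) ∈ ballProduct F (m + 1) r} ≠ ⊤ := by
    refine ne_top_of_le_ne_top (measure_closedBall_lt_top (x := (0 : sectionSpace (F := F) a ha))
      (r := Real.sqrt ((m + 1 : ℕ) * r ^ 2))).ne (measure_mono fun y hy => ?_)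
    rw [mem_closedBall_zero_iff]
    exact Real.le_sqrt_of_sq_le (norm_le_of_mem_ballProduct hy)
  rw [← ENNReal.ofReal_le_iff_le_toReal hfin]
  refine le_trans ?_ (limsup_ballSmoothing_gaussKernel_le (F := F) a ha hc hc0 r)
  rw [← ((ENNReal.continuous_ofReal.tendsto L).comp hL).limsup_eq]
  exact limsup_le_limsup (Eventually.of_forall hD)

end Section

/-! ### Assembling the two inequalities. -/

theorem sum_sq_eq_one_of_norm_eq_one {n : ℕ} {a : EuclideanSpace ℝ (Fin n)} (ha : ‖a‖ = 1) :
    ∑ j, a j ^ 2 = 1 := by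
  have h := EuclideanSpace.real_norm_sq_eq a
  rw [ha, one_pow] at h
  exact h.symm

theorem sectionVolumeReal_eq {m : ℕ} (a : EuclideanSpace ℝ (Fin (m + 1))) :
    sectionVolumeReal a = (μHE[Module.finrank ℝ ℝ * m] (ballProduct ℝ (m + 1) (1 / 2) ∩
      {x | ∑ j, a j • x j = 0})).toReal := by
  have hset : {x : EuclideanSpace ℝ (Fin (m + 1)) | inner ℝ a x = 0} =
      {x | ∑ j, a j • x j = 0} := by
    ext x
    simp [PiLp.inner_apply, mul_comm]
  rw [sectionVolumeReal, hset, Module.finrank_self, one_mul, Nat.add_sub_cancel]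
  rfl

theorem sectionVolumeComplex_eq {m : ℕ} (a : EuclideanSpace ℝ (Fin (m + 1))) :
    sectionVolumeComplex (complexify a) =
      (μHE[Module.finrank ℝ ℂ * m] (ballProduct ℂ (m + 1) (1 / Real.sqrt Real.pi) ∩
        {x | ∑ j, a j • x j = 0})).toReal := by
  have hset : {x : EuclideanSpace ℂ (Fin (m + 1)) | inner ℂ (complexify a) x = 0} =
      {x | ∑ j, a j • x j = 0} := by
    ext x
    simp [PiLp.inner_apply, complexify, mul_comm]
  rw [sectionVolumeComplex, hset, Complex.finrank_real_complex, Nat.add_sub_cancel]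
  rfl

theorem HasImproperIntegral.real_le_sectionVolumeReal {m : ℕ} {a : EuclideanSpace ℝ (Fin (m + 1))}
    (ha : ‖a‖ = 1) {k : Fin (m + 1)} {L : ℝ} (h : HasImproperIntegral (integrandReal a k) L) :
    2 / Real.pi * L ≤ sectionVolumeReal a := by
  have hc : ∀ n : ℕ, (0 : ℝ) < 1 / ((n : ℝ) + 1) := fun n => by positivity
  have hlim := (h.tendsto_integral_mul_gaussian (continuous_integrandReal a k)
    (fun s => (abs_integrandReal_le a k s).trans (le_add_of_nonneg_right (abs_nonneg s)))
    (c := fun n => 2 * (1 / ((n : ℝ) + 1))) (fun n => by positivity)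
    (by simpa using tendsto_one_div_add_atTop_nhds_zero_nat.const_mul (2 : ℝ))).const_mul
      (2 / Real.pi)
  rw [sectionVolumeReal_eq]
  refine le_toReal_euclideanHausdorffMeasure a (sum_sq_eq_one_of_norm_eq_one ha) hc
    tendsto_one_div_add_atTop_nhds_zero_nat (1 / 2) (fun n => ?_) hlim
  -- The regularised integral is the smoothed density of the partial sum at `a_k · 1/2`, with `1/2`
  -- on the boundary of the ball.
  rw [← integral_pi_gaussKernel_real (hc n) a k, ← ballSmoothing_gaussKernel]
  exact ballSmoothing_succAbove_smul_le (radiallyDecreasing_gaussKernel _)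
    ((continuous_gaussKernel _).measurable.ennreal_ofReal)
    (by rw [Real.volume_closedBall]; norm_num) a k (by norm_num)

theorem HasImproperIntegral.complex_le_sectionVolumeComplex {m : ℕ}
    {a : EuclideanSpace ℝ (Fin (m + 1))} (ha : ‖a‖ = 1) {k : Fin (m + 1)} {L : ℝ}
    (h : HasImproperIntegral (integrandComplex a k) L) :
    1 / 2 * L ≤ sectionVolumeComplex (complexify a) := by
  have hpi := Real.pi_pos
  have hr : 0 < 1 / Real.sqrt Real.pi := by positivity
  have hr2 : Real.pi * (1 / Real.sqrt Real.pi) ^ 2 = 1 := by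
    rw [div_pow, one_pow, Real.sq_sqrt hpi.le, mul_one_div_cancel hpi.ne']
  have hvol : volume (Metric.closedBall (0 : ℂ) (1 / Real.sqrt Real.pi)) = 1 := by
    have hpi' : (NNReal.pi : ENNReal) = ENNReal.ofReal Real.pi := by
      rw [← NNReal.coe_real_pi, ENNReal.ofReal_coe_nnreal]
    rw [Complex.volume_closedBall, hpi', ← ENNReal.ofReal_pow hr.le, mul_comm,
      ← ENNReal.ofReal_mul hpi.le, hr2, ENNReal.ofReal_one]
  set r := 1 / Real.sqrt Real.pi
  have hc : ∀ n : ℕ, (0 : ℝ) < 1 / ((n : ℝ) + 1) := fun n => by positivity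
  have hlim := (h.tendsto_integral_mul_gaussian (continuous_integrandComplex a k)
    (fun s => (abs_integrandComplex_le a k s).trans (le_add_of_nonneg_left zero_le_one))
    (c := fun n => r⁻¹ * (1 / ((n : ℝ) + 1))) (fun n => by positivity)
    (by simpa using tendsto_one_div_add_atTop_nhds_zero_nat.const_mul r⁻¹)).const_mul (1 / 2)
  rw [sectionVolumeComplex_eq]
  refine le_toReal_euclideanHausdorffMeasure a (sum_sq_eq_one_of_norm_eq_one ha) hc
    tendsto_one_div_add_atTop_nhds_zero_nat r (fun n => ?_) hlim
  rw [← integral_pi_gaussKernel_complex hr hr2 (hc n) a k, ← ballSmoothing_gaussKernel]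
  exact ballSmoothing_succAbove_smul_le (radiallyDecreasing_gaussKernel _)
    ((continuous_gaussKernel _).measurable.ennreal_ofReal) hvol a k
    (by rw [Complex.norm_real, Real.norm_of_nonneg hr.le])

/-- Divergence, as for `a = ±e_k`, gives the value `0`, and the inequality then reduces to
nonnegativity of a volume. -/
theorem improperIntegral_cases (f : ℝ → ℝ) :
    HasImproperIntegral f (improperIntegral f) ∨ improperIntegral f = 0 := by
  unfold improperIntegral
  split_ifs with h
  · exact Or.inl h.choose_spec
  · exact Or.inr rfl

theorem dReal_le_sectionVolumeReal {m : ℕ} {a : EuclideanSpace ℝ (Fin (m + 1))} (ha : ‖a‖ = 1)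
    (k : Fin (m + 1)) : dReal a k ≤ sectionVolumeReal a := by
  rcases improperIntegral_cases (integrandReal a k) with h | h
  · exact h.real_le_sectionVolumeReal ha
  · rw [dReal, h, mul_zero]
    exact ENNReal.toReal_nonneg

theorem dComplex_le_sectionVolumeComplex {m : ℕ} {a : EuclideanSpace ℝ (Fin (m + 1))}
    (ha : ‖a‖ = 1) (k : Fin (m + 1)) : dComplex a k ≤ sectionVolumeComplex (complexify a) := by
  rcases improperIntegral_cases (integrandComplex a k) with h | h
  · exact h.complex_le_sectionVolumeComplex ha
  · rw [dComplex, h, mul_zero]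
    exact ENNReal.toReal_nonneg

end CubeSection

theorem proposition4 (n : ℕ) (a : EuclideanSpace ℝ (Fin n)) (ha : ‖a‖ = 1) (k : Fin n) :
    ((∃ j, j ≠ k ∧ a j ≠ 0) →
      CubeSection.ImproperConvergent (CubeSection.integrandReal a k) ∧
      CubeSection.ImproperConvergent (CubeSection.integrandComplex a k)) ∧
    CubeSection.dReal a k ≤ CubeSection.sectionVolumeReal a ∧
    CubeSection.dComplex a k ≤ CubeSection.sectionVolumeComplex (CubeSection.complexify a) := by
  refine ⟨fun ⟨j, hjk, hj⟩ => ⟨CubeSection.improperConvergent_integrandReal a hjk hj,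
    CubeSection.improperConvergent_integrandComplex a hjk hj⟩, ?_⟩
  cases n with
  | zero => exact k.elim0
  | succ m => exact ⟨CubeSection.dReal_le_sectionVolumeReal ha k,
      CubeSection.dComplex_le_sectionVolumeComplex ha k⟩
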